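/- Let $m\ge 1$ be an integer, let $x_1,\ldots,x_m,y,z$ be coordinates on $\mathbb{C}^{m+2}$, and let $H_1$ and $H_2$ be the hypersurfaces of $\mathbb{C}^{m+2}$ defined by the equations $$x_1^2\cdots x_m^2\,y+z^2+x_1\cdots x_m\,(z^2-1)=1 \qquad\text{and}\qquad x_1^2\cdots x_m^2\,y+z^2+x_1\cdots x_m=1,$$ respectively. Then $H_1$ and $H_2$ are irreducible (more precisely, each of these equations defines an integral closed subscheme of affine space) and smooth over $\mathbb{C}$. They are not isomorphic as algebraic varieties over $\mathbb{C}$, but their complements are: $\mathbb{C}^{m+2}\setminus H_1\simeq\mathbb{C}^{m+2}\setminus H_2$ as algebraic varieties over $\mathbb{C}$. -/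

import Mathlib

open CategoryTheory AlgebraicGeometry

noncomputable section

/-- The ring `ℂ[x₁, …, xₘ, y, z]` of polynomial functions on `ℂ^(m+2)`. -/
abbrev CoordRing (m : ℕ) : Type := MvPolynomial (Fin m ⊕ Fin 2) ℂ

/-- The product `x₁ ⋯ xₘ` of the first `m` coordinates. -/
def xProd (m : ℕ) : CoordRing m := ∏ i : Fin m, MvPolynomial.X (Sum.inl i)

/-- The coordinate `y`. -/
def yVar (m : ℕ) : CoordRing m := MvPolynomial.X (Sum.inr 0)

/-- The coordinate `z`. -/
def zVar (m : ℕ) : CoordRing m := MvPolynomial.X (Sum.inr 1)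

/-- The polynomial `x₁² ⋯ xₘ² y + z² + x₁ ⋯ xₘ (z² - 1) - 1`. -/
def poly₁ (m : ℕ) : CoordRing m :=
  xProd m ^ 2 * yVar m + zVar m ^ 2 + xProd m * (zVar m ^ 2 - 1) - 1

/-- The polynomial `x₁² ⋯ xₘ² y + z² + x₁ ⋯ xₘ - 1`. -/
def poly₂ (m : ℕ) : CoordRing m :=
  xProd m ^ 2 * yVar m + zVar m ^ 2 + xProd m - 1

/-- The category of schemes over `ℂ`. A complex algebraic variety is regarded as such a scheme,
so that morphisms of varieties are morphisms over `Spec ℂ`. -/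
abbrev SchemeOverC : Type 1 := Over (Spec (CommRingCat.of ℂ))

/-- The affine scheme `Spec A` over `ℂ` of a `ℂ`-algebra `A`. -/
def specOverC (A : Type) [CommRing A] [Algebra ℂ A] : SchemeOverC :=
  Over.mk (Spec.map (CommRingCat.ofHom (algebraMap ℂ A)))

/-- The affine space `ℂ^(m+2)`, with coordinates `x₁, …, xₘ, y, z`. -/
def affineSpaceC (m : ℕ) : SchemeOverC := specOverC (CoordRing m)

/-- The hypersurface of `ℂ^(m+2)` defined by the equation `P = 0`. -/
def hypersurface {m : ℕ} (P : CoordRing m) : SchemeOverC :=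
  specOverC (CoordRing m ⧸ Ideal.span {P})

/-- The set of points of affine space outside the hypersurface `P = 0`, as an open subset. -/
def complementOpen {m : ℕ} (P : CoordRing m) : (affineSpaceC m).left.Opens :=
  ⟨(PrimeSpectrum.zeroLocus {P})ᶜ, (PrimeSpectrum.isClosed_zeroLocus {P}).isOpen_compl⟩

/-- The complement of the hypersurface `P = 0`, as an open subscheme of affine space. -/
def hypersurfaceComplement {m : ℕ} (P : CoordRing m) : SchemeOverC :=
  Over.mk ((complementOpen P).ι ≫ (affineSpaceC m).hom)

end

/-!
Write `u = x₁ ⋯ xₘ`. Since `1 + u` is invertible modulo `u²`, replacing `y` by `(1 + u) Y` turns the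
first equation into `u² Y + z² = 1`. Both coordinate rings are therefore of the form
`SurfaceRing m s = ℂ[x₁, …, xₘ, Y, z] / (u² Y + z² + s u - 1)`, with `s = 0` and `s = 1`.
This is a free module with basis `1, z` over `ℂ[x₁, …, xₘ][Y]`; its norm form shows that it is a
domain, and it is smooth because `u²` and `2 z` have no common zero on the hypersurface.

*Complements.* Where `P₂ = poly₂` takes the value `c`, the second equation reads
`z² ≡ 1 + c - u` modulo `u²`; where `P₁ = poly₁` takes the value `c`, the first one reads
`z² ≡ 1 + c (1 - u)` modulo `u²`. If `c` is invertible, the substitution of `c x₁` for `x₁`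
transforms the former into the latter (`twist₁₂`, with inverse `twist₂₁`), so that the complements
are isomorphic (`complementEquiv`).

*The hypersurfaces.* The key point is that every locally nilpotent derivation `D` of
`SurfaceRing m s` kills all the `xᵢ` (`derivation_ofBase_X_eq_zero`). The ring is embedded in
the Laurent polynomials in `z` and the `xᵢ`, whose exponents are ordered lexicographically with `z`
first, and `D` extends to them. The leading part of `D` multiplies the monomial of exponent `γ` by
`ℓ γ`, for a linear form `ℓ`, and shifts it by a fixed exponent `d`. By local nilpotency,
`ℓ γ` is a multiple of `-ℓ d` by a natural number for each leading exponent `γ` of the ring. The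
leading exponents form an explicit cone (`exists_hasLead_toLaurent`), in which `D z` and `D xᵢ`
have to lie as well, and this forces `ℓ` to depend on the exponent of `z` only
(`sum_weight_nonneg`). Then `D` lowers the `z`-degree and so kills the `xᵢ`, which have degree zero.

As a consequence the locally nilpotent derivation `u² ∂/∂z - 2 z ∂/∂Y` is carried by an isomorphism
`φ` to a multiple of its counterpart (`exists_eq_mul_stdDerivation`). Its kernel is
`ℂ[x₁, …, xₘ]`, and comparing values at `z` gives `φ z = α z + β` and `φ (u)² = w α u²` over that
ring (`exists_map_zCoord`). With the same for `φ⁻¹`, it follows that `α` is a nonzero constant `c`.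
As `1 - (c z + β)²` is divisible by `u²` in `SurfaceRing m 1`, so are `β` and
`1 - c² (1 - u)` in `ℂ[x₁, …, xₘ]`, which is absurd.
-/

/-! ### Leading exponents in group algebras -/

namespace LaurentLead

open AddMonoidAlgebra

variable {k Γ : Type*} [Field k]

section Euler

variable [AddCommGroup Γ]

/-- The derivation of the group algebra `k[Γ]` multiplying the monomial of exponent `γ` by
`w γ`, for an additive weight `w`. -/
noncomputable def eulerDerivation (w : Γ →+ k) : Derivation k k[Γ] k[Γ] :=
  Derivation.mk'
    ((Finsupp.linearCombination k fun γ => (single γ (w γ) : k[Γ])) ∘ₗ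
      (coeffLinearEquiv k : k[Γ] ≃ₗ[k] Γ →₀ k).toLinearMap) <| by
    intro a b
    induction a using AddMonoidAlgebra.induction_linear with
    | zero => simp
    | add f g hf hg => rw [add_mul, map_add, map_add, hf, hg]; simp only [smul_eq_mul]; ring
    | single γ c =>
      induction b using AddMonoidAlgebra.induction_linear with
      | zero => simp
      | add f g hf hg => rw [mul_add, map_add, map_add, hf, hg]; simp only [smul_eq_mul]; ring
      | single δ d =>
        simp only [single_mul_single, LinearMap.comp_apply, LinearEquiv.coe_coe,
          coeffLinearEquiv_apply, coeff_single, Finsupp.linearCombination_single, smul_single,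
          smul_eq_mul, map_add]
        rw [add_comm δ γ, ← single_add]
        congr 1
        ring

@[simp]
theorem eulerDerivation_single (w : Γ →+ k) (γ : Γ) (c : k) :
    eulerDerivation w (single γ c) = single γ (w γ * c) := by
  simp [eulerDerivation, mul_comm]

theorem coeff_eulerDerivation (w : Γ →+ k) (f : k[Γ]) (γ : Γ) :
    (eulerDerivation w f).coeff γ = w γ * f.coeff γ := by
  classical
  induction f using AddMonoidAlgebra.induction_linear with
  | zero => simp
  | add f g hf hg => rw [map_add, coeff_add, coeff_add, Finsupp.add_apply, hf, hg,
      Finsupp.add_apply, mul_add]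
  | single δ c =>
    rw [eulerDerivation_single, coeff_single, coeff_single, Finsupp.single_apply,
      Finsupp.single_apply]
    split_ifs with h
    · rw [h]
    · simp

end Euler

variable [LinearOrder Γ]

/-- All exponents occurring in `f` are at most `γ`. -/
def LeadLE (f : k[Γ]) (γ : Γ) : Prop := ∀ g, γ < g → f.coeff g = 0

/-- The exponent `γ` is the largest one occurring in `f`. -/
def HasLead (f : k[Γ]) (γ : Γ) : Prop := LeadLE f γ ∧ f.coeff γ ≠ 0

theorem exists_hasLead {f : k[Γ]} (hf : f ≠ 0) : ∃ γ, HasLead f γ := by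
  have hs : f.coeff.support.Nonempty := by
    rw [Finsupp.support_nonempty_iff]
    simpa using hf
  refine ⟨f.coeff.support.max' hs, fun g hg => ?_, ?_⟩
  · by_contra h
    exact absurd (Finset.le_max' _ g (Finsupp.mem_support_iff.2 h)) (not_le.2 hg)
  · exact Finsupp.mem_support_iff.1 (Finset.max'_mem _ hs)

theorem HasLead.ne_zero {f : k[Γ]} {γ : Γ} (h : HasLead f γ) : f ≠ 0 := by
  rintro rfl
  exact h.2 (by simp)

theorem HasLead.le {f : k[Γ]} {γ δ : Γ} (h : HasLead f γ) (h' : LeadLE f δ) : γ ≤ δ := by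
  by_contra hlt
  exact h.2 (h' _ (not_le.1 hlt))

theorem HasLead.unique {f : k[Γ]} {γ δ : Γ} (h : HasLead f γ) (h' : HasLead f δ) : γ = δ :=
  le_antisymm (h.le h'.1) (h'.le h.1)

theorem LeadLE.mono {f : k[Γ]} {γ δ : Γ} (h : LeadLE f γ) (hle : γ ≤ δ) : LeadLE f δ :=
  fun g hg => h g (hle.trans_lt hg)

theorem LeadLE.add {f g : k[Γ]} {γ : Γ} (hf : LeadLE f γ) (hg : LeadLE g γ) :
    LeadLE (f + g) γ := fun a ha => by simp [hf a ha, hg a ha]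

theorem LeadLE.sum {ι : Type*} (s : Finset ι) {f : ι → k[Γ]} {γ : Γ}
    (hf : ∀ i ∈ s, LeadLE (f i) γ) : LeadLE (∑ i ∈ s, f i) γ := fun a ha => by
  rw [coeff_sum, Finsupp.finsetSum_apply]
  exact Finset.sum_eq_zero fun i hi => hf i hi a ha

theorem leadLE_single (γ : Γ) (c : k) : LeadLE (single γ c) γ :=
  fun g hg => by simp [hg.ne]

theorem hasLead_single (γ : Γ) {c : k} (hc : c ≠ 0) : HasLead (single γ c) γ :=
  ⟨fun g hg => by simp [hg.ne], by simpa using hc⟩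

theorem HasLead.add_of_lt {f g : k[Γ]} {γ δ : Γ} (hf : HasLead f γ) (hg : LeadLE g δ)
    (h : δ < γ) : HasLead (f + g) γ :=
  ⟨hf.1.add (hg.mono h.le), by simpa [hg γ h] using hf.2⟩

theorem HasLead.add_of_gt {f g : k[Γ]} {γ δ : Γ} (hf : HasLead f γ) (hg : LeadLE g δ)
    (h : δ < γ) : HasLead (g + f) γ := by
  rw [add_comm]
  exact hf.add_of_lt hg h

theorem hasLead_one [AddCommGroup Γ] : HasLead (1 : k[Γ]) 0 := hasLead_single 0 one_ne_zero

section Mul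

variable [AddCommGroup Γ] [IsOrderedAddMonoid Γ]

theorem LeadLE.mul {f g : k[Γ]} {γ δ : Γ} (hf : LeadLE f γ) (hg : LeadLE g δ) :
    LeadLE (f * g) (γ + δ) := fun a ha => by
  classical
  rw [coeff_mul]
  refine Finset.sum_eq_zero fun b _ => Finset.sum_eq_zero fun c _ => ?_
  dsimp only
  split_ifs with h
  · subst h
    rcases lt_or_ge γ b with hb | hb
    · rw [hf b hb, zero_mul]
    · rcases lt_or_ge δ c with hc | hc
      · rw [hg c hc, mul_zero]
      · exact absurd ha (not_lt.2 (add_le_add hb hc))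
  · rfl

theorem LeadLE.coeff_mul_add {f g : k[Γ]} {γ δ : Γ} (hf : LeadLE f γ) (hg : LeadLE g δ) :
    (f * g).coeff (γ + δ) = f.coeff γ * g.coeff δ := by
  classical
  simp_rw [coeff_mul, Finsupp.sum]
  rw [Finset.sum_eq_single γ, Finset.sum_eq_single δ, if_pos rfl]
  · exact fun b _ hne => if_neg fun he => hne (add_left_cancel he)
  · intro h
    rw [if_pos rfl, Finsupp.notMem_support_iff.1 h, mul_zero]
  · refine fun a ha hne => Finset.sum_eq_zero fun b hb => if_neg fun he => ?_
    have ha' : a ≤ γ := not_lt.1 fun h => Finsupp.mem_support_iff.1 ha (hf a h)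
    have hb' : b ≤ δ := not_lt.1 fun h => Finsupp.mem_support_iff.1 hb (hg b h)
    exact (add_lt_add_of_lt_of_le (lt_of_le_of_ne ha' hne) hb').ne he
  · refine fun h => Finset.sum_eq_zero fun a _ => ite_eq_right_iff.mpr fun _ => ?_
    rw [Finsupp.notMem_support_iff.mp h, zero_mul]

theorem HasLead.mul {f g : k[Γ]} {γ δ : Γ} (hf : HasLead f γ) (hg : HasLead g δ) :
    HasLead (f * g) (γ + δ) :=
  ⟨hf.1.mul hg.1, by rw [hf.1.coeff_mul_add hg.1]; exact mul_ne_zero hf.2 hg.2⟩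

theorem HasLead.pow {f : k[Γ]} {γ : Γ} (hf : HasLead f γ) (n : ℕ) : HasLead (f ^ n) (n • γ) := by
  induction n with
  | zero => simpa using hasLead_one
  | succ n ih => rw [pow_succ, succ_nsmul]; exact ih.mul hf

end Mul

theorem LeadLE.eulerDerivation [AddCommGroup Γ] {f : k[Γ]} {γ : Γ} (hf : LeadLE f γ) (w : Γ →+ k) :
    LeadLE (eulerDerivation w f) γ := fun g hg => by
  rw [coeff_eulerDerivation, hf g hg, mul_zero]

end LaurentLead

/-! ### The coordinate rings as quadratic algebras -/

noncomputable section

/-- The ring `ℂ[x₁, …, xₘ]`. -/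
abbrev BaseRing (m : ℕ) : Type := MvPolynomial (Fin m) ℂ

/-- The product `x₁ ⋯ xₘ`, as an element of `ℂ[x₁, …, xₘ]`. -/
def baseProd (m : ℕ) : BaseRing m := ∏ i : Fin m, MvPolynomial.X i

/-- The polynomial `1 - s x₁ ⋯ xₘ - x₁² ⋯ xₘ² Y` in one variable `Y` over `ℂ[x₁, …, xₘ]`. -/
def zSquare (m : ℕ) (s : ℂ) : Polynomial (BaseRing m) :=
  Polynomial.C (1 - MvPolynomial.C s * baseProd m) - Polynomial.C (baseProd m ^ 2) * Polynomial.X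

/-- The algebra `ℂ[x₁, …, xₘ, Y, z]` with the relation `x₁² ⋯ xₘ² Y + z² + s x₁ ⋯ xₘ = 1`, written
as a quadratic algebra over `ℂ[x₁, …, xₘ][Y]`: its elements are `p + q z` with `p`, `q` polynomials
in `Y`, and `z` is the adjoined square root. -/
abbrev SurfaceRing (m : ℕ) (s : ℂ) : Type :=
  QuadraticAlgebra (Polynomial (BaseRing m)) (zSquare m s) 0

namespace SurfaceRing

variable {m : ℕ} {s : ℂ}

open QuadraticAlgebra Polynomial

theorem baseProd_ne_zero : baseProd m ≠ 0 :=
  Finset.prod_ne_zero_iff.2 fun _ _ => MvPolynomial.X_ne_zero _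

/-- The inclusion of the constants in `Y` and `z`. -/
def ofBase (m : ℕ) (s : ℂ) : BaseRing m →ₐ[ℂ] SurfaceRing m s :=
  (IsScalarTower.toAlgHom ℂ (BaseRing m)[X] (SurfaceRing m s)).comp
    (IsScalarTower.toAlgHom ℂ (BaseRing m) (BaseRing m)[X])

theorem ofBase_apply (r : BaseRing m) : ofBase m s r = ⟨C r, 0⟩ := rfl

/-- The coordinate `Y`. -/
def yCoord (m : ℕ) (s : ℂ) : SurfaceRing m s := ⟨X, 0⟩

/-- The coordinate `z`. -/
def zCoord (m : ℕ) (s : ℂ) : SurfaceRing m s := ⟨0, 1⟩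

theorem ofBase_injective : Function.Injective (ofBase m s) := fun a b h => by
  rw [ofBase_apply, ofBase_apply] at h
  exact C_injective (congrArg QuadraticAlgebra.re h)

theorem algebraMap_eq_ofBase (c : ℂ) :
    algebraMap ℂ (SurfaceRing m s) c = ofBase m s (MvPolynomial.C c) :=
  ((ofBase m s).commutes c).symm

theorem zCoord_sq : zCoord m s ^ 2 = 1 - algebraMap ℂ _ s * ofBase m s (baseProd m) -
    ofBase m s (baseProd m) ^ 2 * yCoord m s := by
  rw [algebraMap_eq_ofBase, ← map_mul, ← map_pow, ← map_one (ofBase m s), ← map_sub, sq]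
  ext : 1
  · rw [re_sub, re_mul, re_mul]
    simp [ofBase_apply, zCoord, yCoord]
    simp [zSquare]
  · simp [ofBase_apply, zCoord, yCoord]

theorem ofBase_mul_yCoord : ofBase m s (baseProd m ^ 2) * yCoord m s =
    ofBase m s (1 - MvPolynomial.C s * baseProd m) - zCoord m s * zCoord m s := by
  rw [← sq, zCoord_sq, algebraMap_eq_ofBase]
  simp only [map_sub, map_mul, map_pow, map_one]
  ring

/-- A `ℂ`-algebra homomorphism out of the surface ring is given by the images of the `xᵢ`, of `Y`,
and of `z`, subject to the defining relation. -/
def liftHom {E : Type*} [CommRing E] [Algebra ℂ E] (f : BaseRing m →ₐ[ℂ] E) (y z : E)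
    (h : z ^ 2 = 1 - algebraMap ℂ E s * f (baseProd m) - f (baseProd m) ^ 2 * y) :
    SurfaceRing m s →ₐ[ℂ] E :=
  let g : (BaseRing m)[X] →+* E := eval₂RingHom f.toRingHom y
  have hg : g (zSquare m s) = z ^ 2 := by
    have : f (MvPolynomial.C s) = algebraMap ℂ E s := f.commutes s
    have hC : ∀ r, g (C r) = f r := fun r => by simp [g]
    have hX : g X = y := by simp [g]
    rw [zSquare, map_sub, map_mul, hC, hC, hX, h]
    simp [this]
  { toFun := fun b => g b.re + g b.im * z
    map_one' := by simp [QuadraticAlgebra.re_one, QuadraticAlgebra.im_one]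
    map_zero' := by simp
    map_add' := fun a b => by simp only [re_add, im_add, map_add]; ring
    map_mul' := fun a b => by
      simp only [re_mul, im_mul, map_add, map_mul, hg, map_zero]; ring
    commutes' := fun c => by
      have : f (MvPolynomial.C c) = algebraMap ℂ E c := f.commutes c
      have hC : ∀ r, g (C r) = f r := fun r => by simp [g]
      rw [algebraMap_eq_ofBase, ofBase_apply, hC, this, map_zero, zero_mul, add_zero] }

section liftHom

variable {E : Type*} [CommRing E] [Algebra ℂ E] (f : BaseRing m →ₐ[ℂ] E) (y z : E)
    (h : z ^ 2 = 1 - algebraMap ℂ E s * f (baseProd m) - f (baseProd m) ^ 2 * y)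

theorem liftHom_apply (b : SurfaceRing m s) : liftHom f y z h b =
    eval₂ f.toRingHom y b.re + eval₂ f.toRingHom y b.im * z := rfl

@[simp]
theorem liftHom_ofBase (r : BaseRing m) : liftHom f y z h (ofBase m s r) = f r := by
  simp [liftHom_apply, ofBase_apply]

@[simp]
theorem liftHom_yCoord : liftHom f y z h (yCoord m s) = y := by
  simp [liftHom_apply, yCoord]

@[simp]
theorem liftHom_zCoord : liftHom f y z h (zCoord m s) = z := by
  simp [liftHom_apply, zCoord]

end liftHom

theorem eq_add_mul (b : SurfaceRing m s) : b = aeval (R := BaseRing m) (yCoord m s) b.re +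
    aeval (R := BaseRing m) (yCoord m s) b.im * zCoord m s := by
  have h : ∀ p : (BaseRing m)[X], aeval (R := BaseRing m) (yCoord m s) p = ⟨p, 0⟩ := fun p => by
    have : (aeval (R := BaseRing m) (yCoord m s)) =
        IsScalarTower.toAlgHom (BaseRing m) (BaseRing m)[X] (SurfaceRing m s) := by
      ext : 1
      simp [yCoord]; rfl
    rw [this]; rfl
  rw [h, h]
  ext : 1 <;> simp [zCoord]

/-- An element built from the coordinates satisfies every property that holds for the coordinates
and the constants and is stable under sums and products. -/
theorem induction {P : SurfaceRing m s → Prop} (hbase : ∀ r, P (ofBase m s r))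
    (hy : P (yCoord m s)) (hz : P (zCoord m s)) (hadd : ∀ a b, P a → P b → P (a + b))
    (hmul : ∀ a b, P a → P b → P (a * b)) (b : SurfaceRing m s) : P b := by
  have h : ∀ p : (BaseRing m)[X], P (aeval (R := BaseRing m) (yCoord m s) p) := fun p => by
    induction p using Polynomial.induction_on' with
    | add p q hp hq => rw [map_add]; exact hadd _ _ hp hq
    | monomial n r =>
      rw [aeval_monomial]
      refine hmul _ _ (hbase r) ?_
      induction n with
      | zero => rw [pow_zero, ← map_one (ofBase m s)]; exact hbase 1
      | succ n ih => rw [pow_succ]; exact hmul _ _ ih hy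
  rw [eq_add_mul b]
  exact hadd _ _ (h _) (hmul _ _ (h _) hz)

theorem algHom_ext' {E : Type*} [CommRing E] [Algebra ℂ E] {f g : SurfaceRing m s →ₐ[ℂ] E}
    (hx : ∀ i, f (ofBase m s (MvPolynomial.X i)) = g (ofBase m s (MvPolynomial.X i)))
    (hy : f (yCoord m s) = g (yCoord m s))
    (hz : f (zCoord m s) = g (zCoord m s)) : f = g := by
  have hbase : f.comp (ofBase m s) = g.comp (ofBase m s) := MvPolynomial.algHom_ext hx
  ext b
  induction b using SurfaceRing.induction with
  | hbase r => exact congrArg (fun h => h r) hbase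
  | hy => exact hy
  | hz => exact hz
  | hadd a b ha hb => rw [map_add, map_add, ha, hb]
  | hmul a b ha hb => rw [map_mul, map_mul, ha, hb]

/-! ### The norm -/

theorem natDegree_zSquare : (zSquare m s).natDegree = 1 := by
  have : (zSquare m s) = C (-(baseProd m ^ 2)) * X + C (1 - MvPolynomial.C s * baseProd m) := by
    rw [zSquare, Polynomial.C_neg]; ring
  rw [this]
  exact natDegree_linear (neg_ne_zero.2 (pow_ne_zero _ baseProd_ne_zero))

theorem zSquare_ne_zero : zSquare m s ≠ 0 := fun h => by
  have := natDegree_zSquare (m := m) (s := s)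
  rw [h, natDegree_zero] at this
  exact zero_ne_one this

/-- In the norm `p² - (1 - s u - u² Y) q²` of `p + q z` the two terms have `Y`-degrees of different
parity, so they do not cancel. -/
theorem degree_norm (b : SurfaceRing m s) :
    (norm b).degree = max (b.re ^ 2).degree (zSquare m s * b.im ^ 2).degree := by
  have hn : norm b = b.re ^ 2 - zSquare m s * b.im ^ 2 := by rw [norm_def]; ring
  rw [hn]
  by_cases hp : b.re = 0
  · simp [hp]
  by_cases hq : b.im = 0
  · simp [hq]
  have hp' : b.re ^ 2 ≠ 0 := pow_ne_zero _ hp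
  have hq' : zSquare m s * b.im ^ 2 ≠ 0 := mul_ne_zero zSquare_ne_zero (pow_ne_zero _ hq)
  have hne : (b.re ^ 2).degree ≠ (zSquare m s * b.im ^ 2).degree := by
    rw [degree_eq_natDegree hp', degree_eq_natDegree hq', natDegree_mul zSquare_ne_zero
      (pow_ne_zero _ hq), natDegree_pow, natDegree_pow, natDegree_zSquare]
    norm_cast
    omega
  rcases lt_or_gt_of_ne hne with h | h
  · rw [degree_sub_eq_right_of_degree_lt h, max_eq_right h.le]
  · rw [degree_sub_eq_left_of_degree_lt h, max_eq_left h.le]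

theorem norm_ne_zero {b : SurfaceRing m s} (hb : b ≠ 0) : norm b ≠ 0 := fun h => by
  have := degree_norm b
  rw [h, degree_zero, eq_comm, max_eq_bot, degree_eq_bot, degree_eq_bot] at this
  apply hb
  ext : 1
  · simpa using this.1
  · simpa [zSquare_ne_zero] using this.2

instance : IsDomain (SurfaceRing m s) :=
  haveI : NoZeroDivisors (SurfaceRing m s) := ⟨fun {a b} h => by
    by_contra! hab
    have := congrArg QuadraticAlgebra.norm h
    rw [map_mul, QuadraticAlgebra.norm_zero] at this
    exact mul_ne_zero (norm_ne_zero hab.1) (norm_ne_zero hab.2) this⟩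
  NoZeroDivisors.to_isDomain _

theorem mem_range_ofBase_of_degree_norm {b : SurfaceRing m s} (h : (norm b).degree ≤ 0) :
    ∃ r, b = ofBase m s r := by
  rw [degree_norm, max_le_iff] at h
  have hp : b.re.degree ≤ 0 := by
    have h1 := h.1
    rw [← natDegree_eq_zero_iff_degree_le_zero, natDegree_pow] at h1
    exact natDegree_eq_zero_iff_degree_le_zero.1 (by omega)
  have hq : b.im = 0 := by
    by_contra hq
    have h2 := h.2
    rw [← natDegree_eq_zero_iff_degree_le_zero, natDegree_mul zSquare_ne_zero
      (pow_ne_zero _ hq), natDegree_zSquare] at h2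
    omega
  refine ⟨b.re.coeff 0, ?_⟩
  rw [ofBase_apply, ← eq_C_of_degree_le_zero hp]
  ext : 1
  · rfl
  · exact hq

/-- The constants in `Y` and `z` are factorially closed in the surface ring. -/
theorem mem_range_ofBase_of_mul {a b : SurfaceRing m s} {r : BaseRing m} (hr : r ≠ 0)
    (h : a * b = ofBase m s r) : (∃ r', a = ofBase m s r') ∧ ∃ r', b = ofBase m s r' := by
  have hn : norm a * norm b = C (r ^ 2) := by
    rw [← map_mul, h, ofBase_apply, norm_def]
    simp [sq]
  have hr' : C (r ^ 2) ≠ 0 := by simpa using hr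
  have ha : norm a ≠ 0 := left_ne_zero_of_mul (hn ▸ hr')
  have hb : norm b ≠ 0 := right_ne_zero_of_mul (hn ▸ hr')
  have hd : (norm a).natDegree + (norm b).natDegree = 0 := by
    rw [← natDegree_mul ha hb, hn, natDegree_C]
  constructor
  · exact mem_range_ofBase_of_degree_norm (natDegree_eq_zero_iff_degree_le_zero.1 (by omega))
  · exact mem_range_ofBase_of_degree_norm (natDegree_eq_zero_iff_degree_le_zero.1 (by omega))

end SurfaceRing

end

/-! ### Embedding in Laurent polynomials -/

noncomputable section

/-- The exponents of Laurent monomials in `z` (coordinate `0`) and the `xᵢ` (coordinate `i.succ`),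
ordered lexicographically, the exponent of `z` being compared first. -/
abbrev LaurentExp (m : ℕ) : Type := Lex (Fin (m + 1) → ℤ)

namespace LaurentExp

variable {m : ℕ}

/-- The exponent of the `k`-th variable in a Laurent monomial. -/
def coord (k : Fin (m + 1)) : LaurentExp m →+ ℤ where
  toFun γ := ofLex γ k
  map_zero' := rfl
  map_add' _ _ := rfl

/-- The exponent of the monomial that consists of the `k`-th variable alone. -/
def unit (k : Fin (m + 1)) : LaurentExp m := toLex (Pi.single k 1)

theorem coord_unit (j k : Fin (m + 1)) : coord j (unit k) = if j = k then 1 else 0 := by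
  simp [coord, unit, Pi.single_apply]

theorem coord_zero_le {γ δ : LaurentExp m} (h : γ ≤ δ) : coord 0 γ ≤ coord 0 δ := by
  rcases h.eq_or_lt with rfl | ⟨i, hi, hlt⟩
  · exact le_rfl
  · rcases (Fin.zero_le i).eq_or_lt with rfl | h0
    · exact hlt.le
    · exact (hi 0 h0).le

theorem lt_of_coord_zero_lt {γ δ : LaurentExp m} (h : coord 0 γ < coord 0 δ) : γ < δ :=
  not_le.1 fun hle => absurd (coord_zero_le hle) (not_le.2 h)

end LaurentExp

namespace SurfaceRing

open LaurentExp LaurentLead AddMonoidAlgebra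

variable {m : ℕ} {s : ℂ}

/-- The ring of Laurent polynomials in `z` and the `xᵢ`. -/
abbrev LaurentRing (m : ℕ) : Type := AddMonoidAlgebra ℂ (LaurentExp m)

/-- The inclusion of `ℂ[x₁, …, xₘ]` in the Laurent polynomials. -/
def baseToLaurent (m : ℕ) : BaseRing m →ₐ[ℂ] LaurentRing m :=
  MvPolynomial.aeval fun i => single (unit i.succ) 1

/-- The exponent of `x₁ ⋯ xₘ`. -/
def prodExp (m : ℕ) : LaurentExp m := ∑ i : Fin m, unit i.succ

theorem coord_zero_prodExp : coord 0 (prodExp m) = 0 := by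
  rw [prodExp, map_sum]
  exact Finset.sum_eq_zero fun i _ => by rw [coord_unit, if_neg (Fin.succ_ne_zero i).symm]

theorem coord_succ_prodExp (i : Fin m) : coord i.succ (prodExp m) = 1 := by
  rw [prodExp, map_sum, Finset.sum_eq_single i]
  · rw [coord_unit, if_pos rfl]
  · intro j _ hj
    rw [coord_unit, if_neg fun h => hj (Fin.succ_injective _ h).symm]
  · simp

theorem prod_single {ι : Type*} (t : Finset ι) (g : ι → LaurentExp m) :
    ∏ i ∈ t, (single (g i) 1 : LaurentRing m) = single (∑ i ∈ t, g i) 1 := by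
  classical
  induction t using Finset.induction_on with
  | empty => simp [AddMonoidAlgebra.one_def]
  | insert a t ha ih => rw [Finset.prod_insert ha, Finset.sum_insert ha, ih, single_mul_single,
      one_mul]

theorem baseToLaurent_baseProd : baseToLaurent m (baseProd m) = single (prodExp m) 1 := by
  rw [baseProd, map_prod, prodExp, ← prod_single]
  simp [baseToLaurent]

/-- The exponent of a monomial in the `xᵢ`. -/
def monomialExp (a : Fin m →₀ ℕ) : LaurentExp m := ∑ i : Fin m, a i • unit i.succ

theorem coord_zero_monomialExp (a : Fin m →₀ ℕ) : coord 0 (monomialExp a) = 0 := by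
  rw [monomialExp, map_sum]
  exact Finset.sum_eq_zero fun i _ => by
    rw [map_nsmul, coord_unit, if_neg (Fin.succ_ne_zero i).symm, smul_zero]

theorem coord_succ_monomialExp (a : Fin m →₀ ℕ) (i : Fin m) :
    coord i.succ (monomialExp a) = a i := by
  rw [monomialExp, map_sum, Finset.sum_eq_single i]
  · rw [map_nsmul, coord_unit, if_pos rfl]; simp
  · intro j _ hj
    rw [map_nsmul, coord_unit, if_neg fun h => hj (Fin.succ_injective _ h).symm, smul_zero]
  · simp

theorem monomialExp_injective : Function.Injective (monomialExp (m := m)) := fun a b h => by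
  ext i
  have := congrArg (coord i.succ) h
  rw [coord_succ_monomialExp, coord_succ_monomialExp] at this
  exact_mod_cast this

theorem baseToLaurent_monomial (a : Fin m →₀ ℕ) (c : ℂ) :
    baseToLaurent m (MvPolynomial.monomial a c) = single (monomialExp a) c := by
  rw [baseToLaurent, MvPolynomial.aeval_monomial, Finsupp.prod_fintype _ _ (by simp)]
  simp_rw [single_pow, one_pow]
  rw [prod_single, monomialExp]
  simp [AddMonoidAlgebra.coe_algebraMap, single_mul_single]

theorem coeff_baseToLaurent (r : BaseRing m) (a : Fin m →₀ ℕ) :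
    (baseToLaurent m r).coeff (monomialExp a) = r.coeff a := by
  classical
  induction r using MvPolynomial.induction_on' with
  | monomial b c =>
    rw [baseToLaurent_monomial, coeff_single, Finsupp.single_apply, MvPolynomial.coeff_monomial]
    simp only [monomialExp_injective.eq_iff]
  | add p q hp hq => rw [map_add, coeff_add, Finsupp.add_apply, hp, hq, MvPolynomial.coeff_add]

theorem exists_of_coeff_baseToLaurent_ne_zero (r : BaseRing m) {γ : LaurentExp m}
    (h : (baseToLaurent m r).coeff γ ≠ 0) : ∃ a, monomialExp a = γ := by
  classical
  contrapose! h
  induction r using MvPolynomial.induction_on' with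
  | monomial b c => rw [baseToLaurent_monomial, coeff_single, Finsupp.single_apply, if_neg (h b)]
  | add p q hp hq => rw [map_add, coeff_add, Finsupp.add_apply, hp, hq, add_zero]

theorem exists_hasLead_baseToLaurent {r : BaseRing m} (hr : r ≠ 0) :
    ∃ γ, HasLead (baseToLaurent m r) γ ∧ coord 0 γ = 0 ∧ ∀ i : Fin m, 0 ≤ coord i.succ γ := by
  obtain ⟨a, ha⟩ := MvPolynomial.ne_zero_iff.1 hr
  have hne : baseToLaurent m r ≠ 0 := fun h => ha (by rw [← coeff_baseToLaurent, h]; rfl)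
  obtain ⟨γ, hγ⟩ := exists_hasLead hne
  obtain ⟨b, rfl⟩ := exists_of_coeff_baseToLaurent_ne_zero r hγ.2
  exact ⟨_, hγ, coord_zero_monomialExp b, fun i => by rw [coord_succ_monomialExp]; positivity⟩

/-- The image of `Y` in the Laurent polynomials. -/
def yLaurent (m : ℕ) (s : ℂ) : LaurentRing m :=
  (1 - algebraMap ℂ _ s * baseToLaurent m (baseProd m) - single (unit 0) 1 ^ 2) *
    single (-(2 • prodExp m)) 1

/-- The embedding of the surface ring in the Laurent polynomials in `z` and the `xᵢ`, which is
possible because `Y` is a rational function of `z` and the `xᵢ`. -/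
def toLaurent (m : ℕ) (s : ℂ) : SurfaceRing m s →ₐ[ℂ] LaurentRing m :=
  liftHom (baseToLaurent m) (yLaurent m s) (single (unit 0) 1) <| by
    have h : baseToLaurent m (baseProd m) ^ 2 * single (-(2 • prodExp m)) (1 : ℂ) = 1 := by
      rw [baseToLaurent_baseProd, single_pow, single_mul_single, add_neg_cancel]
      simp [AddMonoidAlgebra.one_def]
    rw [yLaurent, mul_left_comm, h]
    ring

theorem toLaurent_ofBase (r : BaseRing m) : toLaurent m s (ofBase m s r) = baseToLaurent m r :=
  liftHom_ofBase _ _ _ _ _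

theorem toLaurent_yCoord : toLaurent m s (yCoord m s) = yLaurent m s := liftHom_yCoord _ _ _ _

theorem toLaurent_zCoord : toLaurent m s (zCoord m s) = single (unit 0) 1 := liftHom_zCoord _ _ _ _

theorem hasLead_yLaurent : HasLead (yLaurent m s) (2 • unit 0 - 2 • prodExp m) := by
  have hz : HasLead (-(single (unit 0) 1 ^ 2) : LaurentRing m) (2 • unit 0) := by
    rw [single_pow, one_pow, ← single_neg]
    exact hasLead_single _ (neg_ne_zero.2 one_ne_zero)
  have hu : LeadLE (-(algebraMap ℂ _ s * baseToLaurent m (baseProd m)) : LaurentRing m)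
      (prodExp m) := by
    rw [baseToLaurent_baseProd, ← Algebra.smul_def, smul_single, ← single_neg]
    exact leadLE_single _ _
  have h0 : coord 0 (2 • unit 0 : LaurentExp m) = 2 := by
    rw [map_nsmul, coord_unit, if_pos rfl]; simp
  have h := ((hz.add_of_lt hasLead_one.1 (lt_of_coord_zero_lt (by rw [h0, map_zero]; norm_num))
    ).add_of_lt hu (lt_of_coord_zero_lt (by rw [h0, coord_zero_prodExp]; norm_num))).mul
    (hasLead_single (-(2 • prodExp m)) (one_ne_zero (α := ℂ)))
  rw [← sub_eq_add_neg] at h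
  convert h using 1
  · rw [yLaurent]
    ring
  · exact sub_eq_add_neg _ _

/-- The leading exponents of the polynomials in `Y`. -/
theorem exists_hasLead_eval₂ (n : ℕ) : ∀ {p : Polynomial (BaseRing m)}, p ≠ 0 → p.natDegree = n →
    ∃ γ, HasLead (p.eval₂ (baseToLaurent m).toRingHom (yLaurent m s)) γ ∧ coord 0 γ = 2 * n ∧
      ∀ i : Fin m, -(2 * n : ℤ) ≤ coord i.succ γ := by
  induction n using Nat.strong_induction_on with
  | _ n ih =>
  intro p hp hn
  obtain ⟨δ, hδ, hδ0, hδi⟩ := exists_hasLead_baseToLaurent (Polynomial.leadingCoeff_ne_zero.2 hp)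
  have hlead := hδ.mul ((hasLead_yLaurent (m := m) (s := s)).pow n)
  have hU : ∀ i : Fin m, coord i.succ (unit 0 : LaurentExp m) = 0 := fun i => by
    rw [coord_unit, if_neg (Fin.succ_ne_zero i)]
  have h0 : coord 0 (δ + n • (2 • unit 0 - 2 • prodExp m)) = 2 * n := by
    rw [map_add, hδ0, map_nsmul, map_sub, map_nsmul, map_nsmul, coord_zero_prodExp, coord_unit,
      if_pos rfl]
    simp [mul_comm]
  refine ⟨_, ?_, h0, fun i => ?_⟩
  · rw [← p.eraseLead_add_C_mul_X_pow, Polynomial.eval₂_add, hn]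
    have hX : (Polynomial.C p.leadingCoeff * Polynomial.X ^ n).eval₂ (baseToLaurent m).toRingHom
        (yLaurent m s) = baseToLaurent m p.leadingCoeff * yLaurent m s ^ n := by
      simp
    rw [hX]
    rcases p.eraseLead_natDegree_lt_or_eraseLead_eq_zero with hlt | hz
    · by_cases hz : p.eraseLead = 0
      · rw [hz, Polynomial.eval₂_zero, zero_add]; exact hlead
      obtain ⟨ε, hε, hε0, -⟩ := ih _ (hn ▸ hlt) hz rfl
      refine hlead.add_of_gt hε.1 (lt_of_coord_zero_lt ?_)
      rw [h0, hε0]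
      have : p.eraseLead.natDegree < n := hn ▸ hlt
      omega
    · rw [hz, Polynomial.eval₂_zero, zero_add]; exact hlead
  · have := hδi i
    rw [map_add, map_nsmul, map_sub, map_nsmul, map_nsmul, coord_succ_prodExp, hU]
    simp
    linarith

/-- The leading exponent of an element of the surface ring: its exponent `n` of `z` is not
negative, and its exponents of the `xᵢ` are at least `-2 ⌊n / 2⌋`. -/
theorem exists_hasLead_toLaurent {b : SurfaceRing m s} (hb : b ≠ 0) :
    ∃ γ, HasLead (toLaurent m s b) γ ∧ 0 ≤ coord 0 γ ∧
      ∀ i : Fin m, -(2 * (coord 0 γ / 2)) ≤ coord i.succ γ := by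
  have hform : toLaurent m s b = b.re.eval₂ (baseToLaurent m).toRingHom (yLaurent m s) +
      b.im.eval₂ (baseToLaurent m).toRingHom (yLaurent m s) * single (unit 0) 1 := rfl
  rw [hform]
  have hre : b.re ≠ 0 → ∃ γ, HasLead (b.re.eval₂ (baseToLaurent m).toRingHom (yLaurent m s)) γ ∧
      (∃ n : ℕ, coord 0 γ = 2 * n) ∧ ∀ i : Fin m, -(2 * (coord 0 γ / 2)) ≤ coord i.succ γ :=
    fun h => by
    obtain ⟨γ, h1, h2, h3⟩ := exists_hasLead_eval₂ (s := s) _ h rfl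
    refine ⟨γ, h1, ⟨_, h2⟩, fun i => ?_⟩
    have := h3 i
    omega
  have him : b.im ≠ 0 → ∃ γ, HasLead (b.im.eval₂ (baseToLaurent m).toRingHom (yLaurent m s) *
      single (unit 0) 1) γ ∧ (∃ n : ℕ, coord 0 γ = 2 * n + 1) ∧
      ∀ i : Fin m, -(2 * (coord 0 γ / 2)) ≤ coord i.succ γ := fun h => by
    obtain ⟨γ, h1, h2, h3⟩ := exists_hasLead_eval₂ (s := s) _ h rfl
    have h0 : coord 0 (γ + unit 0) = 2 * b.im.natDegree + 1 := by
      rw [map_add, h2, coord_unit, if_pos rfl]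
    refine ⟨_, h1.mul (hasLead_single (unit 0) one_ne_zero), ⟨_, h0⟩, fun i => ?_⟩
    have := h3 i
    rw [h0, map_add, coord_unit, if_neg (Fin.succ_ne_zero i)]
    omega
  by_cases hp : b.re = 0
  · have hq : b.im ≠ 0 := fun hq => hb (QuadraticAlgebra.ext hp hq)
    obtain ⟨γ, h1, ⟨n, h2⟩, h3⟩ := him hq
    rw [hp, Polynomial.eval₂_zero, zero_add]
    exact ⟨γ, h1, by omega, h3⟩
  obtain ⟨γ, h1, ⟨n, h2⟩, h3⟩ := hre hp
  by_cases hq : b.im = 0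
  · rw [hq, Polynomial.eval₂_zero, zero_mul, add_zero]
    exact ⟨γ, h1, by omega, h3⟩
  obtain ⟨δ, h4, ⟨n', h5⟩, h6⟩ := him hq
  rcases lt_or_ge (coord 0 γ) (coord 0 δ) with h | h
  · exact ⟨δ, h4.add_of_gt h1.1 (lt_of_coord_zero_lt h), by omega, h6⟩
  · exact ⟨γ, h1.add_of_lt h4.1 (lt_of_coord_zero_lt (by omega)), by omega, h3⟩

theorem toLaurent_injective : Function.Injective (toLaurent m s) :=
  (injective_iff_map_eq_zero _).2 fun b hb => by
    by_contra h
    obtain ⟨γ, hγ, -⟩ := exists_hasLead_toLaurent h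
    exact hγ.ne_zero hb

end SurfaceRing

end

/-! ### Locally nilpotent derivations -/

noncomputable section

namespace SurfaceRing

open LaurentExp LaurentLead AddMonoidAlgebra

variable {m : ℕ} {s : ℂ}

/-- The coordinates `z` (for `k = 0`) and `xᵢ` (for `k = i.succ`) of the surface ring. -/
def coordElem (m : ℕ) (s : ℂ) (k : Fin (m + 1)) : SurfaceRing m s :=
  Fin.cases (zCoord m s) (fun i => ofBase m s (MvPolynomial.X i)) k

theorem toLaurent_coordElem (k : Fin (m + 1)) :
    toLaurent m s (coordElem m s k) = single (unit k) 1 := by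
  refine Fin.cases ?_ (fun i => ?_) k
  · exact toLaurent_zCoord
  · change toLaurent m s (ofBase m s (MvPolynomial.X i)) = _
    rw [toLaurent_ofBase, baseToLaurent, MvPolynomial.aeval_X]

/-- The weight of a Laurent exponent that is given by its `k`-th coordinate. -/
def coordWeight (k : Fin (m + 1)) : LaurentExp m →+ ℂ := (Int.castAddHom ℂ).comp (coord k)

variable (D : Derivation ℂ (SurfaceRing m s) (SurfaceRing m s))

/-- The logarithmic derivative `D a / a` of the `k`-th coordinate `a`. -/
def logDeriv (k : Fin (m + 1)) : LaurentRing m :=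
  toLaurent m s (D (coordElem m s k)) * single (-unit k) 1

/-- The extension of a derivation of the surface ring to the Laurent polynomials. -/
def extendDerivation : Derivation ℂ (LaurentRing m) (LaurentRing m) :=
  ∑ k, logDeriv D k • eulerDerivation (coordWeight k)

theorem extendDerivation_apply (f : LaurentRing m) :
    extendDerivation D f = ∑ k, logDeriv D k * eulerDerivation (coordWeight k) f := by
  have h := congrFun (map_sum (Derivation.coeFnAddMonoidHom (R := ℂ) (A := LaurentRing m)
    (M := LaurentRing m)) (fun k => logDeriv D k • eulerDerivation (coordWeight k)) Finset.univ) f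
  rw [Finset.sum_apply] at h
  exact h

theorem extendDerivation_coordElem (j : Fin (m + 1)) :
    extendDerivation D (toLaurent m s (coordElem m s j)) = toLaurent m s (D (coordElem m s j)) := by
  rw [extendDerivation_apply, toLaurent_coordElem, Finset.sum_eq_single j]
  · rw [eulerDerivation_single, logDeriv, mul_assoc, single_mul_single, neg_add_cancel]
    simp [coordWeight, coord_unit, ← AddMonoidAlgebra.one_def]
  · intro k _ hk
    rw [eulerDerivation_single]
    simp [coordWeight, coord_unit, hk]
  · simp

theorem extendDerivation_toLaurent (b : SurfaceRing m s) :
    extendDerivation D (toLaurent m s b) = toLaurent m s (D b) := by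
  have hmul : ∀ a b : SurfaceRing m s,
      extendDerivation D (toLaurent m s a) = toLaurent m s (D a) →
      extendDerivation D (toLaurent m s b) = toLaurent m s (D b) →
      extendDerivation D (toLaurent m s (a * b)) = toLaurent m s (D (a * b)) := fun a b ha hb => by
    rw [map_mul, Derivation.leibniz, Derivation.leibniz, ha, hb]
    simp
  have hbase : ∀ r, extendDerivation D (toLaurent m s (ofBase m s r)) =
      toLaurent m s (D (ofBase m s r)) := fun r => by
    induction r using MvPolynomial.induction_on with
    | C c =>
      rw [← MvPolynomial.algebraMap_eq, AlgHom.commutes, AlgHom.commutes,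
        Derivation.map_algebraMap, Derivation.map_algebraMap, map_zero]
    | add p q hp hq => simp only [map_add, hp, hq]
    | mul_X p i hp => rw [map_mul]; exact hmul _ _ hp (extendDerivation_coordElem D i.succ)
  have hz : extendDerivation D (toLaurent m s (zCoord m s)) = toLaurent m s (D (zCoord m s)) :=
    extendDerivation_coordElem D 0
  induction b using SurfaceRing.induction with
  | hbase r => exact hbase r
  | hz => exact hz
  | hadd a b ha hb => simp only [map_add, ha, hb]
  | hmul a b ha hb => exact hmul a b ha hb
  | hy =>
    -- `u² Y` is a polynomial in `z` and the `xᵢ`, and `u² ≠ 0` can be cancelled.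
    have h2 := congrArg (fun b => extendDerivation D (toLaurent m s b) - toLaurent m s (D b))
      (ofBase_mul_yCoord (m := m) (s := s))
    have h3 := hbase (baseProd m ^ 2)
    have h4 : toLaurent m s (ofBase m s (baseProd m ^ 2)) ≠ 0 := fun h0 => by
      rw [toLaurent_ofBase, map_pow, baseToLaurent_baseProd, single_pow] at h0
      simp at h0
    simp only [map_sub (toLaurent m s), map_sub D, map_sub (extendDerivation D), hbase,
      hmul _ _ hz hz, sub_self] at h2
    rw [map_mul (toLaurent m s), Derivation.leibniz, Derivation.leibniz, h3, map_add] at h2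
    simp only [smul_eq_mul, map_mul (toLaurent m s)] at h2
    refine mul_left_cancel₀ h4 ?_
    linear_combination h2

theorem exists_bound_logDeriv (h : ∃ k, logDeriv D k ≠ 0) :
    ∃ d, (∀ k, LeadLE (logDeriv D k) d) ∧ ∃ k, (logDeriv D k).coeff d ≠ 0 := by
  classical
  obtain ⟨k, hk⟩ := h
  obtain ⟨γ, hγ⟩ := exists_hasLead hk
  have hne : (Finset.univ.biUnion fun k => (logDeriv D k).coeff.support).Nonempty :=
    ⟨γ, Finset.mem_biUnion.2 ⟨k, Finset.mem_univ _, Finsupp.mem_support_iff.2 hγ.2⟩⟩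
  refine ⟨Finset.max' _ hne, fun j g hg => ?_, ?_⟩
  · by_contra h
    exact absurd (Finset.le_max' _ g (Finset.mem_biUnion.2
      ⟨j, Finset.mem_univ _, Finsupp.mem_support_iff.2 h⟩)) (not_le.2 hg)
  · obtain ⟨j, -, hj⟩ := Finset.mem_biUnion.1 (Finset.max'_mem _ hne)
    exact ⟨j, Finsupp.mem_support_iff.1 hj⟩

/-- The weight by which the leading part of a derivation, of degree `d`, multiplies the monomials
before it shifts them by `d`. -/
def leadWeight (d : LaurentExp m) : LaurentExp m →+ ℂ :=
  ∑ k, (AddMonoidHom.mulLeft ((logDeriv D k).coeff d)).comp (coordWeight k)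

theorem leadWeight_apply (d γ : LaurentExp m) :
    leadWeight D d γ = ∑ k, (logDeriv D k).coeff d * coord k γ := by
  rw [leadWeight, AddMonoidHom.finsetSum_apply]
  rfl

theorem leadWeight_unit (d : LaurentExp m) (k : Fin (m + 1)) :
    leadWeight D d (unit k) = (logDeriv D k).coeff d := by
  rw [leadWeight_apply, Finset.sum_eq_single k]
  · simp [coord_unit]
  · intro j _ hj
    simp [coord_unit, hj]
  · simp

variable {D} {d : LaurentExp m} (hd : ∀ k, LeadLE (logDeriv D k) d)

include hd in
theorem leadLE_extendDerivation {f : LaurentRing m} {γ : LaurentExp m} (hf : LeadLE f γ) :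
    LeadLE (extendDerivation D f) (γ + d) ∧
      (extendDerivation D f).coeff (γ + d) = leadWeight D d γ * f.coeff γ := by
  rw [extendDerivation_apply, add_comm γ d]
  refine ⟨LeadLE.sum _ fun k _ => (hd k).mul (hf.eulerDerivation _), ?_⟩
  rw [coeff_sum, Finsupp.finsetSum_apply, leadWeight_apply, Finset.sum_mul]
  refine Finset.sum_congr rfl fun k _ => ?_
  rw [(hd k).coeff_mul_add (hf.eulerDerivation _), coeff_eulerDerivation, mul_assoc]
  rfl

include hd in
/-- If some iterate of `D` kills `b`, then one of the factors by which the iterates multiply the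
leading coefficient of `b` vanishes. -/
theorem exists_leadWeight_eq_zero {b : SurfaceRing m s} {γ : LaurentExp m}
    (hb : HasLead (toLaurent m s b) γ) {n : ℕ} (hn : D^[n] b = 0) :
    ∃ i : ℕ, leadWeight D d γ + i * leadWeight D d d = 0 := by
  by_contra! hne
  have key : ∀ k : ℕ, HasLead (toLaurent m s (D^[k] b)) (γ + k • d) := fun k => by
    induction k with
    | zero => simpa using hb
    | succ k ih =>
      rw [Function.iterate_succ_apply', ← extendDerivation_toLaurent, succ_nsmul, ← add_assoc]
      obtain ⟨h1, h2⟩ := leadLE_extendDerivation hd ih.1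
      refine ⟨h1, ?_⟩
      rw [h2, map_add, map_nsmul, nsmul_eq_mul]
      exact mul_ne_zero (hne k) ih.2
  refine (key n).ne_zero ?_
  rw [hn, map_zero]

/-- Let `l` be nonnegative weights of `z` and the `xᵢ` for which `Y` has nonnegative weight. If the
shifts by `d` of the exponents of `z` and of one `xᵢ` lie in the cone of leading exponents of the
surface ring, then `d` has nonnegative weight. -/
theorem sum_weight_nonneg {l : Fin (m + 1) → ℕ} {d : LaurentExp m} {i₀ : Fin m}
    (hl : ∑ i : Fin m, l i.succ ≤ l 0)
    (hx0 : 0 ≤ coord 0 d) (hx : ∀ i : Fin m,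
      -(2 * (coord 0 d / 2)) ≤ coord i.succ d + if i = i₀ then 1 else 0)
    (hz : -(2 * ((coord 0 d + 1) / 2)) ≤ coord i₀.succ d) :
    0 ≤ ∑ k, (l k : ℤ) * coord k d := by
  have h1 : ∀ i : Fin m, -coord 0 d ≤ coord i.succ d := fun i => by
    have := hx i
    by_cases hi : i = i₀
    · subst hi
      rw [if_pos rfl] at this
      omega
    · rw [if_neg hi] at this
      omega
  rw [Fin.sum_univ_succ]
  have h2 : ∑ i : Fin m, (l i.succ : ℤ) * (-coord 0 d) ≤
      ∑ i : Fin m, (l i.succ : ℤ) * coord i.succ d :=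
    Finset.sum_le_sum fun i _ => mul_le_mul_of_nonneg_left (h1 i) (Int.natCast_nonneg _)
  rw [← Finset.sum_mul] at h2
  have h3 : (∑ i : Fin m, (l i.succ : ℤ)) ≤ l 0 := by exact_mod_cast hl
  nlinarith

/-- A locally nilpotent derivation of the surface ring kills the coordinates `xᵢ`: in terms of its
leading part, of degree `d`, all weight lies on `z`, so that `d` is negative in `z`. -/
theorem derivation_ofBase_X_eq_zero (D : Derivation ℂ (SurfaceRing m s) (SurfaceRing m s))
    (hD : ∀ b, ∃ n : ℕ, D^[n] b = 0) (i : Fin m) : D (ofBase m s (MvPolynomial.X i)) = 0 := by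
  by_contra hne
  have hlog : ∀ k, toLaurent m s (D (coordElem m s k)) = logDeriv D k * single (unit k) 1 :=
    fun k => by
    rw [logDeriv, mul_assoc, single_mul_single, neg_add_cancel, one_mul,
      ← AddMonoidAlgebra.one_def, mul_one]
  have hex : ∃ k, logDeriv D k ≠ 0 := ⟨i.succ, fun h => hne <| toLaurent_injective <| by
    have := hlog i.succ
    rw [h, zero_mul] at this
    rw [map_zero]
    exact this⟩
  obtain ⟨d, hd, k₀, hk₀⟩ := exists_bound_logDeriv D hex
  have hlead : ∀ {b : SurfaceRing m s} {γ : LaurentExp m}, HasLead (toLaurent m s b) γ →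
      ∃ i : ℕ, leadWeight D d γ + i * leadWeight D d d = 0 := fun {b γ} hb => by
    obtain ⟨n, hn⟩ := hD b
    exact exists_leadWeight_eq_zero hd hb hn
  have hunit : ∀ k, HasLead (toLaurent m s (coordElem m s k)) (unit k) := fun k => by
    rw [toLaurent_coordElem]
    exact hasLead_single _ one_ne_zero
  -- `d` has weight `c`, and `z` and the `xᵢ` have weights `-l c` with natural numbers `l`
  choose l hl using fun k => hlead (hunit k)
  set c := leadWeight D d d with hc
  have hl' : ∀ k, (logDeriv D k).coeff d = -(l k * c) := fun k => by
    have := hl k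
    rw [leadWeight_unit] at this
    linear_combination this
  have hc0 : c ≠ 0 := fun h => hk₀ (by rw [hl', h]; simp)
  have hW : ∀ γ, leadWeight D d γ = -c * ((∑ k, (l k : ℤ) * coord k γ : ℤ) : ℂ) := fun γ => by
    rw [leadWeight_apply]
    push_cast
    rw [Finset.mul_sum]
    refine Finset.sum_congr rfl fun k _ => ?_
    rw [hl']
    ring
  have hneg : ∑ k, (l k : ℤ) * coord k d = -1 := by
    have h := hW d
    rw [← hc] at h
    have h1 : ((∑ k, (l k : ℤ) * coord k d : ℤ) : ℂ) = ((-1 : ℤ) : ℂ) := by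
      refine mul_left_cancel₀ hc0 ?_
      push_cast at h ⊢
      linear_combination h
    exact_mod_cast h1
  have hy : ∑ i : Fin m, l i.succ ≤ l 0 := by
    have h1 : HasLead (toLaurent m s (yCoord m s)) (2 • unit 0 - 2 • prodExp m) := by
      rw [toLaurent_yCoord]
      exact hasLead_yLaurent
    obtain ⟨j, hj⟩ := hlead h1
    have hU : ∀ i : Fin m, coord i.succ (unit 0 : LaurentExp m) = 0 := fun i => by
      rw [coord_unit, if_neg (Fin.succ_ne_zero i)]
    have hV : coord 0 (unit 0 : LaurentExp m) = 1 := by rw [coord_unit, if_pos rfl]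
    have hsum : ∑ k, (l k : ℤ) * coord k (2 • unit 0 - 2 • prodExp m) =
        2 * l 0 - 2 * ∑ i : Fin m, (l i.succ : ℤ) := by
      rw [Fin.sum_univ_succ, Finset.mul_sum, sub_eq_add_neg (2 * (l 0 : ℤ)),
        ← Finset.sum_neg_distrib]
      congr 1
      · simp only [map_sub, map_nsmul, coord_zero_prodExp, hV]
        simp [mul_comm]
      · refine Finset.sum_congr rfl fun i _ => ?_
        simp only [map_sub, map_nsmul, coord_succ_prodExp, hU]
        simp [mul_comm]
    rw [hW, hsum] at hj
    have h2 : ((j : ℤ) : ℂ) = ((2 * l 0 - 2 * ∑ i : Fin m, (l i.succ : ℤ) : ℤ) : ℂ) := by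
      refine mul_left_cancel₀ hc0 ?_
      push_cast at hj ⊢
      linear_combination hj
    have h3 : (j : ℤ) = 2 * l 0 - 2 * ∑ i : Fin m, (l i.succ : ℤ) := by exact_mod_cast h2
    have h4 : (∑ i : Fin m, (l i.succ : ℤ)) ≤ l 0 := by omega
    exact_mod_cast h4
  -- the leading exponents of `D z` and `D xᵢ`, when the weights are positive
  have hshift : ∀ k, l k ≠ 0 → HasLead (toLaurent m s (D (coordElem m s k))) (unit k + d) :=
    fun k hk => by
    rw [hlog, add_comm _ d]
    have hs : HasLead (logDeriv D k) d :=
      ⟨hd k, by rw [hl']; exact neg_ne_zero.2 (mul_ne_zero (Nat.cast_ne_zero.2 hk) hc0)⟩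
    exact hs.mul (hasLead_single _ one_ne_zero)
  have hcone : ∀ {b : SurfaceRing m s} {γ : LaurentExp m}, HasLead (toLaurent m s b) γ →
      0 ≤ coord 0 γ ∧ ∀ i : Fin m, -(2 * (coord 0 γ / 2)) ≤ coord i.succ γ := fun {b γ} hb => by
    have hb0 : b ≠ 0 := by
      rintro rfl
      exact hb.ne_zero (map_zero _)
    obtain ⟨δ, h1, h2⟩ := exists_hasLead_toLaurent hb0
    rwa [hb.unique h1]
  -- since `d` has weight `-1` relative to `l`, the `xᵢ` cannot have positive weight
  have hl0 : ∀ i : Fin m, l i.succ = 0 := by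
    by_contra! h
    obtain ⟨i₀, hi₀⟩ := h
    have hz0 : l 0 ≠ 0 := fun h0 => hi₀ <| by
      rw [h0, Nat.le_zero, Finset.sum_eq_zero_iff] at hy
      exact hy i₀ (Finset.mem_univ _)
    obtain ⟨h1, h2⟩ := hcone (hshift _ hi₀)
    obtain ⟨-, h4⟩ := hcone (hshift _ hz0)
    have e1 : coord 0 (unit i₀.succ + d) = coord 0 d := by
      rw [map_add, coord_unit, if_neg (Fin.succ_ne_zero i₀).symm, zero_add]
    have e2 : coord 0 (unit 0 + d) = coord 0 d + 1 := by
      rw [map_add, coord_unit, if_pos rfl, add_comm]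
    have := sum_weight_nonneg (i₀ := i₀) hy (e1 ▸ h1) (fun i => ?_) ?_
    · rw [hneg] at this
      omega
    · have h := h2 i
      rw [e1, map_add, coord_unit, add_comm (ite _ _ _)] at h
      simpa only [Fin.succ_inj] using h
    · have h := h4 i₀
      rwa [e2, map_add, coord_unit, if_neg (Fin.succ_ne_zero i₀), zero_add] at h
  have hd0 : coord 0 d < 0 := by
    rw [Fin.sum_univ_succ] at hneg
    simp only [hl0, Nat.cast_zero, zero_mul, Finset.sum_const_zero, add_zero] at hneg
    by_contra! h
    have : 0 ≤ (l 0 : ℤ) * coord 0 d := mul_nonneg (Int.natCast_nonneg _) h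
    omega
  -- `D` lowers the `z`-degree, and `xᵢ` has `z`-degree zero
  obtain ⟨γ, h1, h2, -⟩ := exists_hasLead_toLaurent hne
  have h3 : LeadLE (toLaurent m s (D (ofBase m s (MvPolynomial.X i)))) (d + unit i.succ) := by
    have := hlog i.succ
    change toLaurent m s (D (ofBase m s (MvPolynomial.X i))) = _ at this
    rw [this]
    exact (hd _).mul (leadLE_single _ _)
  have h4 := coord_zero_le (h1.le h3)
  rw [map_add, coord_unit, if_neg (Fin.succ_ne_zero i).symm, add_zero] at h4
  omega

end SurfaceRing

end

/-! ### The two coordinate rings are not isomorphic -/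

noncomputable section

namespace SurfaceRing

open Polynomial QuadraticAlgebra

variable {m : ℕ} {s t : ℂ}

theorem derivative_zSquare : derivative (zSquare m s) = -C (baseProd m ^ 2) := by
  rw [zSquare, derivative_sub, derivative_C, derivative_C_mul, derivative_X, mul_one, zero_sub]

/-- The derivation `u² ∂/∂z - 2 z ∂/∂Y` of the surface ring, for `u = x₁ ⋯ xₘ`. -/
def stdDerivation (m : ℕ) (s : ℂ) : Derivation ℂ (SurfaceRing m s) (SurfaceRing m s) :=
  Derivation.mk'
    { toFun := fun b => ⟨C (baseProd m ^ 2) * b.im - 2 * zSquare m s * derivative b.im,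
        -2 * derivative b.re⟩
      map_add' := fun a b => by
        ext : 1
        · simp only [im_add, derivative_add, re_add]; ring
        · simp only [im_add, derivative_add, re_add]; ring
      map_smul' := fun c b => by
        ext : 1
        · simp only [im_smul, derivative_smul, re_smul, RingHom.id_apply, mul_smul_comm, smul_sub]
        · simp only [im_smul, derivative_smul, re_smul, RingHom.id_apply, mul_smul_comm] } <| by
    intro a b
    ext : 1
    · simp only [LinearMap.coe_mk, AddHom.coe_mk, re_mul, im_mul, re_add, smul_eq_mul,
        derivative_add, derivative_mul, zero_mul, add_zero]
      ring
    · simp only [LinearMap.coe_mk, AddHom.coe_mk, re_mul, im_mul, im_add, smul_eq_mul,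
        derivative_add, derivative_mul, zero_mul, add_zero, derivative_zSquare]
      ring

theorem re_stdDerivation (b : SurfaceRing m s) : (stdDerivation m s b).re =
    C (baseProd m ^ 2) * b.im - 2 * zSquare m s * derivative b.im := rfl

theorem im_stdDerivation (b : SurfaceRing m s) :
    (stdDerivation m s b).im = -2 * derivative b.re := rfl

theorem stdDerivation_zCoord : stdDerivation m s (zCoord m s) = ofBase m s (baseProd m) ^ 2 := by
  rw [← map_pow, ofBase_apply]
  ext : 1
  · simp [re_stdDerivation, zCoord]
  · simp [im_stdDerivation, zCoord]

theorem neg_two_eq : (-2 : SurfaceRing m s) = ⟨-2, 0⟩ := by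
  ext : 1
  · rw [re_neg, re_ofNat]
  · rw [im_neg, im_ofNat, neg_zero]

theorem stdDerivation_yCoord : stdDerivation m s (yCoord m s) = -2 * zCoord m s := by
  rw [neg_two_eq]
  ext : 1
  · simp [re_stdDerivation, zCoord, yCoord]
  · simp [im_stdDerivation, zCoord, yCoord]

theorem stdDerivation_ofBase (r : BaseRing m) : stdDerivation m s (ofBase m s r) = 0 := by
  ext : 1
  · simp [re_stdDerivation, ofBase_apply]
  · simp [im_stdDerivation, ofBase_apply]

theorem coeff_re_stdDerivation (b : SurfaceRing m s) (k : ℕ) : (stdDerivation m s b).re.coeff k =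
    (1 + 2 * (k : BaseRing m)) * baseProd m ^ 2 * b.im.coeff k -
      2 * (1 - MvPolynomial.C s * baseProd m) * (b.im.coeff (k + 1) * ((k : BaseRing m) + 1)) := by
  have h : C (baseProd m ^ 2) * b.im - 2 * zSquare m s * derivative b.im =
      C (baseProd m ^ 2) * b.im - C (2 * (1 - MvPolynomial.C s * baseProd m)) * derivative b.im +
        C (2 * baseProd m ^ 2) * (X * derivative b.im) := by
    have h2 : (C 2 : (BaseRing m)[X]) = 2 := map_ofNat _ 2
    have hz : zSquare m s =
        C (1 - MvPolynomial.C s * baseProd m) - C (baseProd m ^ 2) * X := rfl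
    rw [Polynomial.C_mul, Polynomial.C_mul, h2]
    linear_combination -2 * derivative b.im * hz
  have hX : (X * derivative b.im).coeff k = k * b.im.coeff k := by
    cases k with
    | zero => simp
    | succ k => rw [coeff_X_mul, coeff_derivative]; push_cast; ring
  rw [re_stdDerivation, h, coeff_add, coeff_sub, coeff_C_mul, coeff_C_mul, coeff_C_mul, hX,
    coeff_derivative]
  ring

theorem coeff_im_stdDerivation (b : SurfaceRing m s) (k : ℕ) :
    (stdDerivation m s b).im.coeff k = -2 * (b.re.coeff (k + 1) * ((k : BaseRing m) + 1)) := by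
  have : (-2 : (BaseRing m)[X]) = C (-2) := by rw [Polynomial.C_neg, map_ofNat]
  rw [im_stdDerivation, this, coeff_C_mul, coeff_derivative]

/-- The derivation `u² ∂/∂z - 2 z ∂/∂Y` lowers the `z`-degree, where `Y` has degree two. -/
theorem stdDerivation_locallyNilpotent (b : SurfaceRing m s) :
    ∃ n : ℕ, (stdDerivation m s)^[n] b = 0 := by
  have key : ∀ (n : ℕ) (b : SurfaceRing m s), (∀ k, n ≤ 2 * k → b.re.coeff k = 0) →
      (∀ k, n ≤ 2 * k + 1 → b.im.coeff k = 0) → (stdDerivation m s)^[n] b = 0 := fun n => by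
    induction n with
    | zero =>
      intro b hr hi
      ext k : 2
      · exact hr k (Nat.zero_le _)
      · exact hi k (Nat.zero_le _)
    | succ n ih =>
      intro b hr hi
      rw [Function.iterate_succ_apply]
      refine ih _ (fun k hk => ?_) fun k hk => ?_
      · rw [coeff_re_stdDerivation, hi k (by omega), hi (k + 1) (by omega)]
        ring
      · rw [coeff_im_stdDerivation, hr (k + 1) (by omega)]
        ring
  refine ⟨2 * (b.re.natDegree + b.im.natDegree + 1), key _ _ (fun k hk => ?_) fun k hk => ?_⟩
  · exact coeff_eq_zero_of_natDegree_lt (by omega)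
  · exact coeff_eq_zero_of_natDegree_lt (by omega)

theorem exists_of_stdDerivation_eq_ofBase {b : SurfaceRing m s} {r : BaseRing m}
    (h : stdDerivation m s b = ofBase m s r) :
    ∃ α β, b = ofBase m s α * zCoord m s + ofBase m s β ∧ r = baseProd m ^ 2 * α := by
  have him : b.im = C (b.im.coeff 0) := by
    refine eq_C_of_natDegree_eq_zero ?_
    by_contra hk
    have h2 := congrArg (fun c : SurfaceRing m s => c.re.coeff b.im.natDegree) h
    rw [coeff_re_stdDerivation, coeff_eq_zero_of_natDegree_lt (Nat.lt_succ_self b.im.natDegree),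
      ofBase_apply, coeff_C, if_neg hk, zero_mul, mul_zero, sub_zero] at h2
    have h3 : (1 + 2 * (b.im.natDegree : BaseRing m)) ≠ 0 := by
      exact_mod_cast (by omega : 1 + 2 * b.im.natDegree ≠ 0)
    refine mul_ne_zero (mul_ne_zero h3 (pow_ne_zero 2 baseProd_ne_zero)) ?_ h2
    exact leadingCoeff_ne_zero.2 fun h0 => hk (by rw [h0, natDegree_zero])
  have hre : b.re = C (b.re.coeff 0) := by
    refine eq_C_of_natDegree_eq_zero (Polynomial.derivative_eq_zero.1 ?_)
    have h1 := congrArg QuadraticAlgebra.im h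
    rw [im_stdDerivation, ofBase_apply] at h1
    simpa using h1
  refine ⟨b.im.coeff 0, b.re.coeff 0, ?_, ?_⟩
  · rw [ofBase_apply, ofBase_apply, ← him, ← hre]
    ext : 1
    · simp [zCoord]
    · simp [zCoord]
  · have h1 := congrArg (fun c : SurfaceRing m s => c.re.coeff 0) h
    rw [coeff_re_stdDerivation, ofBase_apply, coeff_C_zero] at h1
    rw [← h1, him]
    simp

theorem exists_of_stdDerivation_eq_zero {b : SurfaceRing m s} (h : stdDerivation m s b = 0) :
    ∃ β, b = ofBase m s β := by
  obtain ⟨α, β, h1, h2⟩ := exists_of_stdDerivation_eq_ofBase (r := 0) (h.trans (map_zero _).symm)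
  have hα : α = 0 :=
    (mul_eq_zero.1 h2.symm).resolve_left (pow_ne_zero 2 baseProd_ne_zero)
  exact ⟨β, by rw [h1, hα, map_zero, zero_mul, zero_add]⟩

theorem derivation_ofBase_eq_zero (D : Derivation ℂ (SurfaceRing m s) (SurfaceRing m s))
    (hD : ∀ i, D (ofBase m s (MvPolynomial.X i)) = 0) (r : BaseRing m) :
    D (ofBase m s r) = 0 := by
  induction r using MvPolynomial.induction_on with
  | C c => rw [← MvPolynomial.algebraMap_eq, AlgHom.commutes, Derivation.map_algebraMap]
  | add p q hp hq => rw [map_add, map_add, hp, hq, add_zero]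
  | mul_X p i hp => rw [map_mul, Derivation.leibniz, hp, hD, smul_zero, smul_zero, add_zero]

/-- The element `z` is regular modulo `u²`, because `1 - s u` is invertible modulo `u²`, with
inverse `1 + s u`. -/
theorem exists_eq_mul_of_mul_eq {a b : SurfaceRing m s}
    (h : ofBase m s (baseProd m ^ 2) * a = -2 * zCoord m s * b) :
    ∃ w, b = ofBase m s (baseProd m ^ 2) * w := by
  obtain ⟨a₁, a₂⟩ := a
  obtain ⟨b₁, b₂⟩ := b
  have hre : C (baseProd m ^ 2) * a₁ = -2 * (zSquare m s * b₂) := by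
    have h' := congrArg QuadraticAlgebra.re h
    rw [neg_two_eq, ofBase_apply] at h'
    simp only [zCoord, re_mul, im_mul, mul_zero, zero_mul, add_zero, mul_one, zero_add] at h'
    linear_combination h'
  have him : C (baseProd m ^ 2) * a₂ = -2 * b₁ := by
    have h' := congrArg QuadraticAlgebra.im h
    rw [neg_two_eq, ofBase_apply] at h'
    simp only [zCoord, re_mul, im_mul, mul_zero, zero_mul, add_zero, mul_one, zero_add] at h'
    linear_combination h'
  obtain ⟨κ, hκ⟩ : ∃ κ : (BaseRing m)[X], κ * 2 = 1 := by
    refine ⟨C (MvPolynomial.C (1 / 2)), ?_⟩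
    have h2 : (2 : (BaseRing m)[X]) = C (MvPolynomial.C 2) := by rw [map_ofNat, map_ofNat]
    rw [h2, ← Polynomial.C_mul, ← MvPolynomial.C_mul]
    simp
  refine ⟨⟨-κ * a₂, (1 + C (MvPolynomial.C s) * C (baseProd m)) *
    (X * b₂ - κ * a₁) + C (MvPolynomial.C s) ^ 2 * b₂⟩, ?_⟩
  rw [ofBase_apply]
  ext : 1
  · simp only [re_mul, mul_zero, zero_mul, add_zero]
    linear_combination κ * him - b₁ * hκ
  · simp only [im_mul, zero_mul, add_zero]
    clear h him
    rw [zSquare] at hre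
    simp only [Polynomial.C_sub, Polynomial.C_mul, Polynomial.C_pow, Polynomial.C_1] at hre ⊢
    linear_combination (1 + C (MvPolynomial.C s) * C (baseProd m)) * κ *
      hre - (1 + C (MvPolynomial.C s) * C (baseProd m)) * (1 - C (MvPolynomial.C s) *
        C (baseProd m) - C (baseProd m) ^ 2 * X) * b₂ * hκ

/-- The derivations that kill the `xᵢ` form a free module over the surface ring, generated by
`u² ∂/∂z - 2 z ∂/∂Y`. -/
theorem exists_eq_mul_stdDerivation (D : Derivation ℂ (SurfaceRing m s) (SurfaceRing m s))
    (hD : ∀ i, D (ofBase m s (MvPolynomial.X i)) = 0) :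
    ∃ w, ∀ b, D b = w * stdDerivation m s b := by
  have hbase := derivation_ofBase_eq_zero D hD
  have hDrel : ofBase m s (baseProd m ^ 2) * D (yCoord m s) =
      -2 * zCoord m s * D (zCoord m s) := by
    have h := congrArg D (ofBase_mul_yCoord (m := m) (s := s))
    rw [map_sub, Derivation.leibniz, Derivation.leibniz, hbase, hbase] at h
    simp only [smul_eq_mul] at h
    linear_combination h
  obtain ⟨w, hw⟩ := exists_eq_mul_of_mul_eq hDrel
  have hu : ofBase m s (baseProd m ^ 2) ≠ 0 :=
    (map_ne_zero_iff _ ofBase_injective).2 (pow_ne_zero 2 baseProd_ne_zero)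
  refine ⟨w, fun b => ?_⟩
  induction b using SurfaceRing.induction with
  | hbase r => rw [hbase, stdDerivation_ofBase, mul_zero]
  | hz => rw [hw, stdDerivation_zCoord, map_pow, mul_comm]
  | hy =>
    refine mul_left_cancel₀ hu ?_
    rw [hDrel, hw, stdDerivation_yCoord]
    ring
  | hadd a b ha hb => rw [map_add, map_add, ha, hb, mul_add]
  | hmul a b ha hb =>
    rw [Derivation.leibniz, Derivation.leibniz, ha, hb]
    simp only [smul_eq_mul]
    ring

/-- The conjugate of the standard derivation by an isomorphism. -/
def conjStdDerivation (φ : SurfaceRing m s ≃ₐ[ℂ] SurfaceRing m t) :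
    Derivation ℂ (SurfaceRing m t) (SurfaceRing m t) :=
  Derivation.mk' (φ.toLinearMap ∘ₗ (stdDerivation m s).toLinearMap ∘ₗ φ.symm.toLinearMap) <| by
    intro a b
    simp [Derivation.leibniz]

theorem conjStdDerivation_apply (φ : SurfaceRing m s ≃ₐ[ℂ] SurfaceRing m t)
    (b : SurfaceRing m t) : conjStdDerivation φ b = φ (stdDerivation m s (φ.symm b)) := rfl

theorem conjStdDerivation_ofBase_X (φ : SurfaceRing m s ≃ₐ[ℂ] SurfaceRing m t) (i : Fin m) :
    conjStdDerivation φ (ofBase m t (MvPolynomial.X i)) = 0 := by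
  refine derivation_ofBase_X_eq_zero _ (fun b => ?_) i
  obtain ⟨n, hn⟩ := stdDerivation_locallyNilpotent (φ.symm b)
  have key : ∀ n : ℕ, (conjStdDerivation φ)^[n] b = φ ((stdDerivation m s)^[n] (φ.symm b)) :=
    fun n => by
    induction n with
    | zero => simp
    | succ n ih =>
      rw [Function.iterate_succ_apply', ih, conjStdDerivation_apply, Function.iterate_succ_apply',
        AlgEquiv.symm_apply_apply]
  exact ⟨n, by rw [key, hn, map_zero]⟩

/-- An isomorphism of surface rings preserves `ℂ[x₁, …, xₘ]`, which is killed by all locally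
nilpotent derivations and is the kernel of one of them. -/
theorem exists_map_ofBase (φ : SurfaceRing m s ≃ₐ[ℂ] SurfaceRing m t) (r : BaseRing m) :
    ∃ r', φ (ofBase m s r) = ofBase m t r' := by
  have h := derivation_ofBase_eq_zero _ (conjStdDerivation_ofBase_X φ.symm) r
  rw [conjStdDerivation_apply, EmbeddingLike.map_eq_zero_iff, AlgEquiv.symm_symm] at h
  exact exists_of_stdDerivation_eq_zero h

/-- An isomorphism of surface rings maps `z` to `α z + β`, and the square of `u` to `w α u²`, with
coefficients in `ℂ[x₁, …, xₘ]`: here `w` is the ratio of the transported standard derivation, which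
maps `φ z` to `φ (u²)`, to the standard one. -/
theorem exists_map_zCoord (φ : SurfaceRing m s ≃ₐ[ℂ] SurfaceRing m t) :
    ∃ w α β, φ (zCoord m s) = ofBase m t α * zCoord m t + ofBase m t β ∧
      φ (ofBase m s (baseProd m)) ^ 2 = ofBase m t (w * α * baseProd m ^ 2) := by
  obtain ⟨v, hv⟩ := exists_map_ofBase φ (baseProd m)
  obtain ⟨w, hw⟩ := exists_eq_mul_stdDerivation _ (conjStdDerivation_ofBase_X φ)
  have hz := hw (φ (zCoord m s))
  rw [conjStdDerivation_apply, AlgEquiv.symm_apply_apply, stdDerivation_zCoord, map_pow φ, hv,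
    ← map_pow (ofBase m t)] at hz
  have hv0 : v ≠ 0 := by
    rintro rfl
    rw [map_zero (ofBase m t), EmbeddingLike.map_eq_zero_iff] at hv
    exact baseProd_ne_zero (ofBase_injective (hv.trans (map_zero (ofBase m s)).symm))
  obtain ⟨⟨w', hw'⟩, r, hr⟩ := mem_range_ofBase_of_mul (pow_ne_zero 2 hv0) hz.symm
  obtain ⟨α, β, h1, h2⟩ := exists_of_stdDerivation_eq_ofBase hr
  refine ⟨w', α, β, h1, ?_⟩
  rw [hv, ← map_pow (ofBase m t), hz, hr, hw', ← map_mul (ofBase m t), h2,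
    mul_assoc, mul_comm α]

theorem isEmpty_algEquiv (hm : 1 ≤ m) : IsEmpty (SurfaceRing m 0 ≃ₐ[ℂ] SurfaceRing m 1) := by
  refine ⟨fun φ => ?_⟩
  obtain ⟨w, α, β, hz, hu⟩ := exists_map_zCoord φ
  obtain ⟨w', α', -, -, hu'⟩ := exists_map_zCoord φ.symm
  obtain ⟨g, hg⟩ := exists_map_ofBase φ (w' * α')
  have hu0 : baseProd m ^ 2 ≠ 0 := pow_ne_zero 2 baseProd_ne_zero
  -- `u² = φ (φ⁻¹ (u²))` is a multiple of `α u²`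
  have hunit : α * (g * w) = 1 := by
    have h := congrArg φ hu'
    rw [map_pow φ, AlgEquiv.apply_symm_apply, map_mul (ofBase m 0), map_mul φ, hg,
      map_pow (ofBase m 0), map_pow φ, hu, ← map_pow (ofBase m 1), ← map_mul (ofBase m 1)] at h
    refine mul_right_cancel₀ hu0 ?_
    linear_combination -(ofBase_injective h)
  obtain ⟨c, hc, rfl⟩ := MvPolynomial.isUnit_iff_eq_C_of_isReduced.1 (IsUnit.of_mul_eq_one _ hunit)
  -- apply `φ` to the relation `u² Y = 1 - z²`
  have hrel : 1 - (ofBase m 1 (MvPolynomial.C c) * zCoord m 1 + ofBase m 1 β) ^ 2 =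
      ofBase m 1 (w * MvPolynomial.C c * baseProd m ^ 2) * φ (yCoord m 0) := by
    have h := congrArg φ (zCoord_sq (m := m) (s := 0))
    simp only [map_sub, map_mul, map_pow, map_one, map_zero, zero_mul, sub_zero] at h
    rw [hz, hu] at h
    rw [h]
    ring
  rw [ofBase_apply, ofBase_apply, ofBase_apply] at hrel
  have hre := congrArg (fun b : SurfaceRing m 1 => b.re.coeff 0) hrel
  have him := congrArg (fun b : SurfaceRing m 1 => b.im.coeff 0) hrel
  rw [sq] at hre him
  simp only [zCoord, re_sub, im_sub, re_one, im_one, re_mul, im_mul, re_add, im_add, mul_zero,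
    zero_mul, add_zero, zero_add, mul_one, zero_sub] at hre him
  have hz0 : (zSquare m 1).coeff 0 = 1 - baseProd m := by simp [zSquare]
  simp only [coeff_sub, coeff_add, coeff_neg, mul_coeff_zero, coeff_one_zero, coeff_C_zero, hz0]
    at hre him
  set y₀ := (φ (yCoord m 0)).re.coeff 0
  set y₁ := (φ (yCoord m 0)).im.coeff 0
  have hc0 : (MvPolynomial.C c : BaseRing m) ≠ 0 := by simpa using hc.ne_zero
  have hβ : -2 * β = w * baseProd m ^ 2 * y₁ := by
    refine mul_left_cancel₀ hc0 ?_
    linear_combination him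
  have heval : MvPolynomial.eval 0 (baseProd m) = (0 : ℂ) := by
    rw [baseProd, map_prod]
    exact Finset.prod_eq_zero (Finset.mem_univ ⟨0, hm⟩) (by simp)
  -- `β` is divisible by `u²`, so `1 - c² + c² u` is divisible by `u²`, which is impossible
  have hmain : 4 * (1 - MvPolynomial.C c ^ 2) + baseProd m * (4 * MvPolynomial.C c ^ 2 -
      w ^ 2 * baseProd m ^ 3 * y₁ ^ 2 - 4 * w * MvPolynomial.C c * baseProd m * y₀) = 0 := by
    linear_combination 4 * hre + (-2 * β + w * baseProd m ^ 2 * y₁) * hβ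
  have hc1 : c ^ 2 = 1 := by
    have h := congrArg (MvPolynomial.eval 0) hmain
    simp only [map_add, map_mul, map_sub, map_pow, heval, MvPolynomial.eval_C, map_one, map_ofNat,
      map_zero, zero_mul, add_zero] at h
    linear_combination -h / 4
  rw [← MvPolynomial.C_pow, hc1, MvPolynomial.C_1, sub_self, mul_zero, zero_add] at hmain
  have h := congrArg (MvPolynomial.eval 0) ((mul_eq_zero.1 hmain).resolve_left baseProd_ne_zero)
  simp only [map_mul, map_sub, map_pow, heval, map_one, map_ofNat, map_zero] at h
  norm_num at h

end SurfaceRing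

end

/-! ### Smoothness and the identification of the coordinate rings -/

noncomputable section

namespace SurfaceRing

variable {m : ℕ} {s : ℂ}

/-- A solution of the defining equation modulo a square-zero ideal is corrected to a solution by a
step of Newton's method: the partial derivatives `u²` and `2 z` with respect to `Y` and `z` generate
the unit ideal on the hypersurface. -/
instance formallySmooth : Algebra.FormallySmooth ℂ (SurfaceRing m s) := by
  refine Algebra.FormallySmooth.of_comp_surjective fun B _ _ I hI f => ?_
  choose x hx using fun i => Ideal.Quotient.mk_surjective (f (ofBase m s (MvPolynomial.X i)))
  obtain ⟨y, hy⟩ := Ideal.Quotient.mk_surjective (f (yCoord m s))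
  obtain ⟨z, hz⟩ := Ideal.Quotient.mk_surjective (f (zCoord m s))
  have hF : ∀ r, Ideal.Quotient.mkₐ ℂ I (MvPolynomial.aeval x r) = f (ofBase m s r) := fun r => by
    have : (Ideal.Quotient.mkₐ ℂ I).comp (MvPolynomial.aeval x) = f.comp (ofBase m s) := by
      ext i
      simp [hx]
    exact congrArg (fun g => g r) this
  set U := MvPolynomial.aeval x (baseProd m) with hU
  set c := algebraMap ℂ B s with hc
  set κ := algebraMap ℂ B (1 / 2) with hκ
  have hκ2 : κ * 2 = 1 := by
    rw [hκ, ← map_ofNat (algebraMap ℂ B) 2, ← map_mul]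
    simp
  set P := U ^ 2 * y + z ^ 2 + c * U - 1 with hP
  have hPI : Ideal.Quotient.mk I P = 0 := by
    have h := congrArg f (zCoord_sq (m := m) (s := s))
    rw [map_pow, map_sub, map_sub, map_mul, map_mul, map_one, map_pow, AlgHom.commutes] at h
    rw [← hF, ← hy, ← hz, ← AlgHom.commutes (Ideal.Quotient.mkₐ ℂ I), ← hU, ← hc] at h
    simp only [Ideal.Quotient.mkₐ_eq_mk] at h
    simp only [hP, map_sub, map_add, map_mul, map_pow, map_one]
    rw [h]
    ring
  have hPP : P * P = 0 := by
    have h := Ideal.Quotient.eq_zero_iff_mem.1 hPI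
    have h2 := Ideal.mul_mem_mul h h
    rwa [← sq, hI, Ideal.mem_bot] at h2
  refine ⟨liftHom (MvPolynomial.aeval x) (y - P * ((1 + c * U) * y + c ^ 2))
    (z - P * (κ * z * (1 + c * U))) ?_, ?_⟩
  · rw [← hU, ← hc]
    linear_combination (κ ^ 2 * z ^ 2 * (1 + c * U) ^ 2 - (1 + c * U)) * hPP -
      P * z ^ 2 * (1 + c * U) * hκ2 + hP
  · refine algHom_ext' (fun i => ?_) ?_ ?_
    · rw [AlgHom.comp_apply, liftHom_ofBase, hF]
    · rw [AlgHom.comp_apply, liftHom_yCoord, ← hy, Ideal.Quotient.mkₐ_eq_mk, map_sub, map_mul, hPI,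
        zero_mul, sub_zero]
    · rw [AlgHom.comp_apply, liftHom_zCoord, ← hz, Ideal.Quotient.mkₐ_eq_mk, map_sub, map_mul, hPI,
        zero_mul, sub_zero]

end SurfaceRing

section Quotients

open SurfaceRing

variable {m : ℕ} {E : Type*} [CommRing E] [Algebra ℂ E]

/-- The homomorphism out of the coordinate ring of `ℂ^(m+2)` with prescribed values at the
coordinates. -/
def coordHom (x : Fin m → E) (y z : E) : CoordRing m →ₐ[ℂ] E :=
  MvPolynomial.aeval (Sum.elim x ![y, z])

section

variable (x : Fin m → E) (y z : E)

@[simp]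
theorem coordHom_X (i : Fin m) : coordHom x y z (MvPolynomial.X (Sum.inl i)) = x i := by
  simp [coordHom]

@[simp]
theorem coordHom_yVar : coordHom x y z (yVar m) = y := by
  simp [coordHom, yVar]

@[simp]
theorem coordHom_zVar : coordHom x y z (zVar m) = z := by
  simp [coordHom, zVar]

theorem coordHom_xProd : coordHom x y z (xProd m) = ∏ i, x i := by
  simp [xProd]

end

theorem coordRing_algHom_ext {f g : CoordRing m →ₐ[ℂ] E}
    (hx : ∀ i, f (MvPolynomial.X (Sum.inl i)) = g (MvPolynomial.X (Sum.inl i)))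
    (hy : f (yVar m) = g (yVar m)) (hz : f (zVar m) = g (zVar m)) : f = g := by
  refine MvPolynomial.algHom_ext fun i => ?_
  rcases i with i | i
  · exact hx i
  · fin_cases i
    · exact hy
    · exact hz

/-- The homomorphism from `ℂ[x₁, …, xₘ]` to the coordinate ring of a hypersurface. -/
def baseToQuotient (P : CoordRing m) : BaseRing m →ₐ[ℂ] CoordRing m ⧸ Ideal.span {P} :=
  MvPolynomial.aeval fun i => Ideal.Quotient.mk _ (MvPolynomial.X (Sum.inl i))

theorem baseToQuotient_baseProd (P : CoordRing m) :
    baseToQuotient P (baseProd m) = Ideal.Quotient.mk _ (xProd m) := by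
  simp [baseToQuotient, baseProd, xProd]

theorem mk_span_singleton_self (P : CoordRing m) :
    Ideal.Quotient.mk (Ideal.span {P}) P = 0 :=
  Ideal.Quotient.eq_zero_iff_mem.2 (Ideal.mem_span_singleton_self P)

theorem prod_ofBase_X (s : ℂ) :
    ∏ i, ofBase m s (MvPolynomial.X i) = ofBase m s (baseProd m) := by
  rw [baseProd, map_prod]

/-- The homomorphism out of the coordinate ring of a hypersurface given by the values at the
coordinates. -/
def quotientHom {P : CoordRing m} (f : CoordRing m →ₐ[ℂ] E) (h : f P = 0) :
    CoordRing m ⧸ Ideal.span {P} →ₐ[ℂ] E :=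
  Ideal.Quotient.liftₐ _ f fun a ha => by
    obtain ⟨b, rfl⟩ := Ideal.mem_span_singleton'.1 ha
    rw [map_mul, h, mul_zero]

@[simp]
theorem quotientHom_mk {P : CoordRing m} (f : CoordRing m →ₐ[ℂ] E) (h : f P = 0)
    (a : CoordRing m) : quotientHom f h (Ideal.Quotient.mk _ a) = f a := rfl

theorem quotient_algHom_ext {P : CoordRing m} {f g : CoordRing m ⧸ Ideal.span {P} →ₐ[ℂ] E}
    (hx : ∀ i, f (Ideal.Quotient.mk _ (MvPolynomial.X (Sum.inl i))) =
      g (Ideal.Quotient.mk _ (MvPolynomial.X (Sum.inl i))))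
    (hy : f (Ideal.Quotient.mk _ (yVar m)) = g (Ideal.Quotient.mk _ (yVar m)))
    (hz : f (Ideal.Quotient.mk _ (zVar m)) = g (Ideal.Quotient.mk _ (zVar m))) : f = g :=
  Ideal.Quotient.algHom_ext _ (coordRing_algHom_ext hx hy hz)

/-- The first defining equation, multiplied by the inverse `1 - u` of `1 + u` modulo `u²`. -/
theorem zSq_of_equation₁ {E : Type*} [CommRing E] {u y z : E}
    (h : u ^ 2 * y + z ^ 2 + u * (z ^ 2 - 1) - 1 = 0) :
    z ^ 2 = 1 - u ^ 2 * (y * (1 - u) - z ^ 2 + 1) := by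
  linear_combination (1 - u) * h

theorem equation₁_of_zSq {E : Type*} [CommRing E] {u y z : E} (h : z ^ 2 = 1 - u ^ 2 * y) :
    u ^ 2 * ((1 + u) * y) + z ^ 2 + u * (z ^ 2 - 1) - 1 = 0 ∧
      (1 + u) * y * (1 - u) - z ^ 2 + 1 = y := by
  constructor
  · linear_combination (1 + u) * h
  · linear_combination -h

theorem mk_equation₁ (m : ℕ) :
    (Ideal.Quotient.mk (Ideal.span {poly₁ m}) (xProd m)) ^ 2 * Ideal.Quotient.mk _ (yVar m) +
      Ideal.Quotient.mk _ (zVar m) ^ 2 + Ideal.Quotient.mk _ (xProd m) *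
        (Ideal.Quotient.mk _ (zVar m) ^ 2 - 1) - 1 = 0 := by
  have h : Ideal.Quotient.mk (Ideal.span {poly₁ m}) (xProd m ^ 2 * yVar m + zVar m ^ 2 +
      xProd m * (zVar m ^ 2 - 1) - 1) = 0 := mk_span_singleton_self (poly₁ m)
  simpa only [map_sub, map_add, map_mul, map_pow, map_one] using h

theorem zCoord_sq_zero : zCoord m 0 ^ 2 = 1 - ofBase m 0 (baseProd m) ^ 2 * yCoord m 0 := by
  rw [zCoord_sq, map_zero, zero_mul, sub_zero]

/-- The homomorphism from the coordinate ring of the first hypersurface to the surface ring that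
maps `y` to `(1 + u) Y`. -/
def quotientToSurface₁ (m : ℕ) : CoordRing m ⧸ Ideal.span {poly₁ m} →ₐ[ℂ] SurfaceRing m 0 :=
  quotientHom (coordHom (fun i => ofBase m 0 (MvPolynomial.X i))
    ((1 + ofBase m 0 (baseProd m)) * yCoord m 0) (zCoord m 0)) <| by
    simp only [poly₁, map_sub, map_add, map_mul, map_pow, map_one, coordHom_xProd, coordHom_yVar,
      coordHom_zVar, prod_ofBase_X]
    exact (equation₁_of_zSq zCoord_sq_zero).1

/-- The homomorphism from the surface ring to the coordinate ring of the first hypersurface that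
maps `Y` to `y (1 - u) - z² + 1`. -/
def surfaceToQuotient₁ (m : ℕ) : SurfaceRing m 0 →ₐ[ℂ] CoordRing m ⧸ Ideal.span {poly₁ m} :=
  liftHom (baseToQuotient _)
    (Ideal.Quotient.mk _ (yVar m) * (1 - Ideal.Quotient.mk _ (xProd m)) -
      Ideal.Quotient.mk _ (zVar m) ^ 2 + 1)
    (Ideal.Quotient.mk _ (zVar m)) <| by
    rw [baseToQuotient_baseProd, map_zero, zero_mul, sub_zero]
    exact zSq_of_equation₁ (mk_equation₁ m)

theorem quotientToSurface₁_xProd : quotientToSurface₁ m (Ideal.Quotient.mk _ (xProd m)) =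
    ofBase m 0 (baseProd m) := by
  rw [quotientToSurface₁, quotientHom_mk, coordHom_xProd, prod_ofBase_X]

theorem quotientToSurface₁_yVar : quotientToSurface₁ m (Ideal.Quotient.mk _ (yVar m)) =
    (1 + ofBase m 0 (baseProd m)) * yCoord m 0 := by
  rw [quotientToSurface₁, quotientHom_mk, coordHom_yVar]

theorem quotientToSurface₁_zVar : quotientToSurface₁ m (Ideal.Quotient.mk _ (zVar m)) =
    zCoord m 0 := by
  rw [quotientToSurface₁, quotientHom_mk, coordHom_zVar]

/-- The coordinate ring of the first hypersurface. -/
def quotientEquiv₁ (m : ℕ) : (CoordRing m ⧸ Ideal.span {poly₁ m}) ≃ₐ[ℂ] SurfaceRing m 0 :=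
  AlgEquiv.ofAlgHom (quotientToSurface₁ m) (surfaceToQuotient₁ m)
    (algHom_ext' (fun i => by simp [quotientToSurface₁, surfaceToQuotient₁, baseToQuotient]) (by
        rw [AlgHom.comp_apply, surfaceToQuotient₁, liftHom_yCoord, map_add, map_sub, map_mul,
          map_sub, map_pow, map_one, quotientToSurface₁_xProd, quotientToSurface₁_yVar,
          quotientToSurface₁_zVar, (equation₁_of_zSq zCoord_sq_zero).2, AlgHom.id_apply])
      (by simp [quotientToSurface₁, surfaceToQuotient₁]))
    (quotient_algHom_ext
      (fun i => by simp [quotientToSurface₁, surfaceToQuotient₁, baseToQuotient]) (by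
        rw [AlgHom.comp_apply, quotientToSurface₁_yVar, surfaceToQuotient₁, map_mul, map_add,
          map_one, liftHom_ofBase, liftHom_yCoord, baseToQuotient_baseProd, AlgHom.id_apply]
        linear_combination -mk_equation₁ m)
      (by simp [quotientToSurface₁, surfaceToQuotient₁]))

/-- The coordinate ring of the second hypersurface. -/
def quotientEquiv₂ (m : ℕ) : (CoordRing m ⧸ Ideal.span {poly₂ m}) ≃ₐ[ℂ] SurfaceRing m 1 :=
  AlgEquiv.ofAlgHom
    (quotientHom (coordHom (fun i => ofBase m 1 (MvPolynomial.X i)) (yCoord m 1) (zCoord m 1)) (by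
      simp only [poly₂, map_sub, map_add, map_mul, map_pow, map_one, coordHom_xProd, coordHom_yVar,
        coordHom_zVar, prod_ofBase_X]
      rw [zCoord_sq, map_one, one_mul]
      ring))
    (liftHom (baseToQuotient _) (Ideal.Quotient.mk _ (yVar m)) (Ideal.Quotient.mk _ (zVar m)) (by
      have h : Ideal.Quotient.mk (Ideal.span {poly₂ m})
          (xProd m ^ 2 * yVar m + zVar m ^ 2 + xProd m - 1) = 0 := mk_span_singleton_self (poly₂ m)
      simp only [map_sub, map_add, map_mul, map_pow, map_one] at h
      rw [baseToQuotient_baseProd, map_one, one_mul]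
      linear_combination h))
    (algHom_ext' (fun i => by simp [baseToQuotient]) (by simp) (by simp))
    (quotient_algHom_ext (fun i => by simp [baseToQuotient]) (by simp) (by simp))

end Quotients

end

/-! ### The complements, and the passage to schemes -/

noncomputable section

section Complements

variable {m : ℕ} {E : Type*} [CommRing E] [Algebra ℂ E]

/-- Multiplication of the coordinate `x_{i₀}` by a factor `c`. -/
def scaleCoord (i₀ : Fin m) (c : E) (f : CoordRing m →ₐ[ℂ] E) (i : Fin m) : E :=
  (if i = i₀ then c else 1) * f (MvPolynomial.X (Sum.inl i))

theorem prod_scaleCoord (i₀ : Fin m) (c : E) (f : CoordRing m →ₐ[ℂ] E) :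
    ∏ i, scaleCoord i₀ c f i = c * f (xProd m) := by
  simp only [scaleCoord, xProd, map_prod]
  rw [Finset.prod_mul_distrib, Finset.prod_ite_eq' Finset.univ i₀, if_pos (Finset.mem_univ _)]

/-- With `c` the value of the first polynomial and `d` its inverse, the change of coordinates
`x_{i₀} ↦ c x_{i₀}`, `y ↦ d² (y (1 - u) - z² + 1)`, which transforms the second polynomial into
the first one. -/
def twist₁₂ (i₀ : Fin m) (f : CoordRing m →ₐ[ℂ] E) (d : E) : CoordRing m →ₐ[ℂ] E :=
  coordHom (scaleCoord i₀ (f (poly₁ m)) f)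
    (d ^ 2 * (f (yVar m) * (1 - f (xProd m)) - f (zVar m) ^ 2 + 1)) (f (zVar m))

/-- With `c` the value of the second polynomial and `d` its inverse, the change of coordinates
`x_{i₀} ↦ d x_{i₀}`, `y ↦ c (c y + u y + 1)`, which transforms the first polynomial into the
second one. -/
def twist₂₁ (i₀ : Fin m) (f : CoordRing m →ₐ[ℂ] E) (d : E) : CoordRing m →ₐ[ℂ] E :=
  coordHom (scaleCoord i₀ d f)
    (f (poly₂ m) * (f (poly₂ m) * f (yVar m) + f (xProd m) * f (yVar m) + 1)) (f (zVar m))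

theorem map_poly₁ (f : CoordRing m →ₐ[ℂ] E) : f (poly₁ m) =
    f (xProd m) ^ 2 * f (yVar m) + f (zVar m) ^ 2 + f (xProd m) * (f (zVar m) ^ 2 - 1) - 1 := by
  simp only [poly₁, map_sub, map_add, map_mul, map_pow, map_one]

theorem map_poly₂ (f : CoordRing m →ₐ[ℂ] E) : f (poly₂ m) =
    f (xProd m) ^ 2 * f (yVar m) + f (zVar m) ^ 2 + f (xProd m) - 1 := by
  simp only [poly₂, map_sub, map_add, map_mul, map_pow, map_one]

theorem twist₁₂_poly₂ (i₀ : Fin m) (f : CoordRing m →ₐ[ℂ] E) {d : E}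
    (h : f (poly₁ m) * d = 1) : twist₁₂ i₀ f d (poly₂ m) = f (poly₁ m) := by
  rw [map_poly₂, twist₁₂, coordHom_xProd, coordHom_yVar, coordHom_zVar, prod_scaleCoord]
  have hp := map_poly₁ f
  generalize f (poly₁ m) = p at *
  generalize f (xProd m) = u at *
  generalize f (yVar m) = y at *
  generalize f (zVar m) = z at *
  linear_combination u ^ 2 * (y * (1 - u) - z ^ 2 + 1) * (p * d + 1) * h + (u - 1) * hp

theorem twist₂₁_poly₁ (i₀ : Fin m) (f : CoordRing m →ₐ[ℂ] E) {d : E}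
    (h : f (poly₂ m) * d = 1) : twist₂₁ i₀ f d (poly₁ m) = f (poly₂ m) := by
  rw [map_poly₁, twist₂₁, coordHom_xProd, coordHom_yVar, coordHom_zVar, prod_scaleCoord]
  have hp := map_poly₂ f
  generalize f (poly₂ m) = p at *
  generalize f (xProd m) = u at *
  generalize f (yVar m) = y at *
  generalize f (zVar m) = z at *
  linear_combination (u ^ 2 * y * (p * d + 1) + u ^ 2 * d * (u * y + 1) + u) * h - (1 + u * d) * hp

variable {E' : Type*} [CommRing E'] [Algebra ℂ E']

theorem comp_twist₁₂ {i₀ : Fin m} {f₁ : CoordRing m →ₐ[ℂ] E} {d₁ : E}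
    (h₁ : f₁ (poly₁ m) * d₁ = 1) {f : CoordRing m →ₐ[ℂ] E'} {d : E'} (h : f (poly₂ m) * d = 1)
    {G : E →ₐ[ℂ] E'} (hG : ∀ a, G (f₁ a) = twist₂₁ i₀ f d a) (a : CoordRing m) :
    G (twist₁₂ i₀ f₁ d₁ a) = f a := by
  have hp : G (f₁ (poly₁ m)) = f (poly₂ m) := by rw [hG, twist₂₁_poly₁ i₀ f h]
  have hd : G d₁ = d := by
    have h₂ := congrArg G h₁
    rw [map_mul, hp, map_one] at h₂
    linear_combination d * h₂ - G d₁ * h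
  suffices hs : G.comp (twist₁₂ i₀ f₁ d₁) = f from congrArg (fun g => g a) hs
  refine coordRing_algHom_ext (fun i => ?_) ?_ ?_
  · rw [AlgHom.comp_apply, twist₁₂, coordHom_X, scaleCoord, map_mul, hG, twist₂₁, coordHom_X,
      scaleCoord]
    split_ifs
    · rw [hp, ← mul_assoc, h, one_mul]
    · rw [map_one, one_mul, one_mul]
  · rw [AlgHom.comp_apply, twist₁₂, coordHom_yVar, map_mul, map_add, map_sub, map_mul, map_sub,
      map_pow, map_pow, map_one, hd, hG, hG, hG, twist₂₁, coordHom_yVar, coordHom_zVar,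
      coordHom_xProd, prod_scaleCoord]
    have hp₂ := map_poly₂ f
    generalize f (poly₂ m) = p at *
    generalize f (xProd m) = u at *
    generalize f (yVar m) = y at *
    generalize f (zVar m) = z at *
    linear_combination (y * (1 - d * u) * (p * d + 1) + (d * u * y + d) * (1 - d * u) - d) * h +
      d ^ 2 * hp₂
  · rw [AlgHom.comp_apply, twist₁₂, coordHom_zVar, hG, twist₂₁, coordHom_zVar]

theorem comp_twist₂₁ {i₀ : Fin m} {f₂ : CoordRing m →ₐ[ℂ] E} {d₂ : E}
    (h₂ : f₂ (poly₂ m) * d₂ = 1) {f : CoordRing m →ₐ[ℂ] E'} {d : E'} (h : f (poly₁ m) * d = 1)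
    {G : E →ₐ[ℂ] E'} (hG : ∀ a, G (f₂ a) = twist₁₂ i₀ f d a) (a : CoordRing m) :
    G (twist₂₁ i₀ f₂ d₂ a) = f a := by
  have hp : G (f₂ (poly₂ m)) = f (poly₁ m) := by rw [hG, twist₁₂_poly₂ i₀ f h]
  have hd : G d₂ = d := by
    have h₁ := congrArg G h₂
    rw [map_mul, hp, map_one] at h₁
    linear_combination d * h₁ - G d₂ * h
  suffices hs : G.comp (twist₂₁ i₀ f₂ d₂) = f from congrArg (fun g => g a) hs
  refine coordRing_algHom_ext (fun i => ?_) ?_ ?_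
  · rw [AlgHom.comp_apply, twist₂₁, coordHom_X, scaleCoord, map_mul, hG, twist₁₂, coordHom_X,
      scaleCoord]
    split_ifs
    · rw [hd, ← mul_assoc, mul_comm d, h, one_mul]
    · rw [map_one, one_mul, one_mul]
  · rw [AlgHom.comp_apply, twist₂₁, coordHom_yVar, map_mul, map_add, map_add, map_mul, map_mul,
      map_one, hp, hG, hG, twist₁₂, coordHom_yVar, coordHom_xProd, prod_scaleCoord]
    have hp₁ := map_poly₁ f
    generalize f (poly₁ m) = p at *
    generalize f (xProd m) = u at *
    generalize f (yVar m) = y at *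
    generalize f (zVar m) = z at *
    linear_combination (1 + u) * (y * (1 - u) - z ^ 2 + 1) * (p * d + 1) * h + hp₁
  · rw [AlgHom.comp_apply, twist₂₁, coordHom_zVar, hG, twist₁₂, coordHom_zVar]

/-- The restriction of polynomial functions to the complement of `P = 0`. -/
def toAway (P : CoordRing m) : CoordRing m →ₐ[ℂ] Localization.Away P :=
  IsScalarTower.toAlgHom ℂ (CoordRing m) (Localization.Away P)

theorem toAway_mul_invSelf (P : CoordRing m) :
    toAway P P * IsLocalization.Away.invSelf P = 1 :=
  IsLocalization.Away.mul_invSelf P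

/-- The extension of a homomorphism to the functions on the complement of `P = 0`. -/
def liftAway {P : CoordRing m} (f : CoordRing m →ₐ[ℂ] E) (h : IsUnit (f P)) :
    Localization.Away P →ₐ[ℂ] E :=
  IsLocalization.Away.liftAlgHom (f := f) P h

theorem liftAway_toAway {P : CoordRing m} (f : CoordRing m →ₐ[ℂ] E) (h : IsUnit (f P))
    (a : CoordRing m) : liftAway f h (toAway P a) = f a :=
  IsLocalization.Away.lift_eq P h a

/-- The isomorphism between the `ℂ`-algebras of functions on the two complements: on the complement
of either hypersurface, the value of its polynomial is a unit, by which `x_{i₀}` is rescaled. -/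
def complementEquiv (i₀ : Fin m) :
    Localization.Away (poly₂ m) ≃ₐ[ℂ] Localization.Away (poly₁ m) :=
  have h₁ := toAway_mul_invSelf (poly₁ m)
  have h₂ := toAway_mul_invSelf (poly₂ m)
  have u₁ : IsUnit (twist₁₂ i₀ (toAway (poly₁ m)) (IsLocalization.Away.invSelf (poly₁ m))
      (poly₂ m)) := by
    rw [twist₁₂_poly₂ i₀ _ h₁]
    exact IsUnit.of_mul_eq_one _ h₁
  have u₂ : IsUnit (twist₂₁ i₀ (toAway (poly₂ m)) (IsLocalization.Away.invSelf (poly₂ m))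
      (poly₁ m)) := by
    rw [twist₂₁_poly₁ i₀ _ h₂]
    exact IsUnit.of_mul_eq_one _ h₂
  AlgEquiv.ofAlgHom (liftAway _ u₁) (liftAway _ u₂)
    (IsLocalization.algHom_ext (Submonoid.powers (poly₁ m)) <| AlgHom.ext fun a => by
      change liftAway _ u₁ (liftAway _ u₂ (toAway _ a)) = toAway _ a
      rw [liftAway_toAway]
      exact comp_twist₂₁ h₂ h₁ (liftAway_toAway _ u₁) a)
    (IsLocalization.algHom_ext (Submonoid.powers (poly₂ m)) <| AlgHom.ext fun a => by
      change liftAway _ u₂ (liftAway _ u₁ (toAway _ a)) = toAway _ a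
      rw [liftAway_toAway]
      exact comp_twist₁₂ h₁ h₂ (liftAway_toAway _ u₂) a)

end Complements

/-- Isomorphic `ℂ`-algebras have isomorphic spectra over `ℂ`. -/
def specOverCIso {A B : Type} [CommRing A] [CommRing B] [Algebra ℂ A] [Algebra ℂ B]
    (e : A ≃ₐ[ℂ] B) : specOverC B ≅ specOverC A :=
  (algSpec (CommRingCat.of ℂ)).mapIso (CommAlgCat.isoMk (R := ℂ) e).op

/-- `ℂ`-algebras with isomorphic spectra over `ℂ` are isomorphic. -/
def algEquivOfSpecOverCIso {A B : Type} [CommRing A] [CommRing B] [Algebra ℂ A] [Algebra ℂ B]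
    (e : specOverC A ≅ specOverC B) : B ≃ₐ[ℂ] A :=
  CommAlgCat.algEquivOfIso (A := CommAlgCat.of ℂ B) (B := CommAlgCat.of ℂ A) <|
    ((algSpec.fullyFaithful (R := CommRingCat.of ℂ)).preimageIso
      (X := Opposite.op (CommAlgCat.of ℂ A)) (Y := Opposite.op (CommAlgCat.of ℂ B)) e).unop

/-- The complement of a hypersurface is the spectrum of the localization of the coordinate ring at
its equation. -/
def hypersurfaceComplementIso {m : ℕ} (P : CoordRing m) :
    hypersurfaceComplement P ≅ specOverC (Localization.Away P) := by
  let g : (specOverC (Localization.Away P)).left ⟶ (affineSpaceC m).left :=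
    Spec.map (CommRingCat.ofHom (algebraMap (CoordRing m) (Localization.Away P)))
  haveI : IsOpenImmersion g := inferInstanceAs <| IsOpenImmersion <|
    Spec.map (CommRingCat.ofHom (algebraMap (CoordRing m) (Localization.Away P)))
  have hr : Set.range (complementOpen P).ι = Set.range g := by
    refine (Scheme.Opens.range_ι (complementOpen P)).trans ?_
    exact ((PrimeSpectrum.localization_away_comap_range (Localization.Away P) P).trans
      (PrimeSpectrum.basicOpen_eq_zeroLocus_compl P)).symm
  let e : (complementOpen P).toScheme ≅ (specOverC (Localization.Away P)).left :=
    IsOpenImmersion.isoOfRangeEq (complementOpen P).ι g hr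
  refine Over.isoMk e ?_
  have h : (specOverC (Localization.Away P)).hom = g ≫ (affineSpaceC m).hom := by
    change Spec.map _ = Spec.map _ ≫ Spec.map _
    rw [← Spec.map_comp, ← CommRingCat.ofHom_comp, ← IsScalarTower.algebraMap_eq]
  change e.hom ≫ (specOverC (Localization.Away P)).hom =
    (complementOpen P).ι ≫ (affineSpaceC m).hom
  rw [h, IsOpenImmersion.isoOfRangeEq_hom_fac_assoc]

theorem isIntegral_specOverC {A : Type} [CommRing A] [Algebra ℂ A] [IsDomain A] :
    AlgebraicGeometry.IsIntegral (specOverC A).left :=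
  (affine_isIntegral_iff (CommRingCat.of A)).2 ‹_›

theorem smooth_specOverC {A : Type} [CommRing A] [Algebra ℂ A] [h : Algebra.Smooth ℂ A] :
    AlgebraicGeometry.Smooth (specOverC A).hom :=
  (HasRingHomProperty.Spec_iff (P := @AlgebraicGeometry.Smooth)).2 (RingHom.smooth_algebraMap.2 h)

theorem smooth_hypersurface {m : ℕ} {P : CoordRing m} {s : ℂ}
    (e : (CoordRing m ⧸ Ideal.span {P}) ≃ₐ[ℂ] SurfaceRing m s) :
    AlgebraicGeometry.Smooth (hypersurface P).hom := by
  have : Algebra.FormallySmooth ℂ (CoordRing m ⧸ Ideal.span {P}) :=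
    Algebra.FormallySmooth.of_equiv e.symm
  have : Algebra.FinitePresentation ℂ (CoordRing m ⧸ Ideal.span {P}) :=
    Algebra.FinitePresentation.quotient ⟨{P}, by simp⟩
  have : Algebra.Smooth ℂ (CoordRing m ⧸ Ideal.span {P}) := {}
  exact smooth_specOverC

theorem isIntegral_hypersurface {m : ℕ} {P : CoordRing m} {s : ℂ}
    (e : (CoordRing m ⧸ Ideal.span {P}) ≃ₐ[ℂ] SurfaceRing m s) :
    AlgebraicGeometry.IsIntegral (hypersurface P).left :=
  haveI : IsDomain (CoordRing m ⧸ Ideal.span {P}) := e.toMulEquiv.isDomain _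
  isIntegral_specOverC

end

theorem mainTheorem3 (m : ℕ) (hm : 1 ≤ m) :
    (AlgebraicGeometry.IsIntegral (hypersurface (poly₁ m)).left ∧
      AlgebraicGeometry.IsIntegral (hypersurface (poly₂ m)).left) ∧
    (AlgebraicGeometry.Smooth (hypersurface (poly₁ m)).hom ∧
      AlgebraicGeometry.Smooth (hypersurface (poly₂ m)).hom) ∧
    IsEmpty (hypersurface (poly₁ m) ≅ hypersurface (poly₂ m)) ∧
    Nonempty (hypersurfaceComplement (poly₁ m) ≅ hypersurfaceComplement (poly₂ m)) := by
  refine ⟨⟨isIntegral_hypersurface (quotientEquiv₁ m), isIntegral_hypersurface (quotientEquiv₂ m)⟩,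
    ⟨smooth_hypersurface (quotientEquiv₁ m), smooth_hypersurface (quotientEquiv₂ m)⟩,
    ⟨fun e => ?_⟩, ⟨?_⟩⟩
  · exact (SurfaceRing.isEmpty_algEquiv hm).false ((quotientEquiv₁ m).symm.trans
      ((algEquivOfSpecOverCIso e).symm.trans (quotientEquiv₂ m)))
  · exact hypersurfaceComplementIso _ ≪≫ specOverCIso (complementEquiv ⟨0, hm⟩) ≪≫
      (hypersurfaceComplementIso _).symm
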